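/- **Conventions.** Let $\lambda$ be a partition of $n$; tableaux are drawn in French notation (row lengths weakly decrease from bottom to top). The reading word $\mathsf{row}(b)$ of a tableau $b$ reads the rows from left to right, top row first. The standardization $\mathsf{std}(b)$ of a semistandard tableau $b$ renumbers its cells by $1,\dots,n$, smaller letters first and equal letters from left to right. For a word $w$ and $k\ge 1$, bracket successively letters $k+1$ with letters $k$ to their right; the crystal operator $f_k$ changes the rightmost unbracketed letter $k$ into $k+1$ (and is undefined if there is none), and it acts on semistandard tableaux through the reading word. The crystal skeleton $\mathsf{CS}(\lambda)$ is the directed graph on the set $\mathsf{SYT}(\lambda)$ of standard tableaux of shape $\lambda$ obtained by contracting the sets $Q_T=\{b : \mathsf{std}(b)=T\}$ in the crystal of semistandard tableaux of shape $\lambda$ over $\{1,\dots,N\}$, $N\ge n$: there is an edge $T\to T'$ if $f_k(b)=b'$ for some $b\in Q_T$, $b'\in Q_{T'}$ and $1\le k<N$, where at least one pair of letters $k+1,k$ of $\mathsf{row}(b)$ is bracketed (otherwise $b'\in Q_T$). Its label is the interval $I=[\pi_p-n_{\mathrm{left}},\ \pi_p+n_{\mathrm{left}}+2n_{\mathrm{right}}]$,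 where $p$ is the position of $\mathsf{row}(b)$ on which $f_k$ acts, $\pi=\mathsf{row}(T)$, and $n_{\mathrm{left}}$, $n_{\mathrm{right}}$ are the numbers of bracketed pairs to the left and to the right of $p$. Thus $I=[i,i+2m]$ with $m=n_{\mathrm{left}}+n_{\mathrm{right}}\ge 1$. Write $I^-=[i,i+m-1]$ and $I^+=[i+m+1,i+2m]$. A letter $d<n$ is a descent of $T\in\mathsf{SYT}(\lambda)$ if $d+1$ lies in a higher row than $d$. If $d_1<\dots<d_s$ are the descents, then $\mathsf{Des}(T)=(d_1,d_2-d_1,\dots,d_s-d_{s-1},n-d_s)$. A composition $\alpha=(\alpha_1,\dots,\alpha_\ell)$ of $n$ is identified with the ordered set partition $(\alpha^{(1)},\dots,\alpha^{(\ell)})$ of $[n]$ into consecutive intervals with $|\alpha^{(r)}|=\alpha_r$. For an interval $[a,b]$ with $2s$ elements, $T$ has a rectangle on $[a,b]$ if $[a,b]\subseteq[1,n]$ and the jeu de taquin straightening of the skew tableau $T_{[a,b]}$ (the restriction of $T$ to the letters in $[a,b]$) has shape $(s,s)$; otherwise $T$ is rectangle-free on $[a,b]$. **Theorem.** Let $T\to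 T'$ be an edge of $\mathsf{CS}(\lambda)$ labelled by $I=[i,i+2m]$, and let $\alpha=\mathsf{Des}(T)$, with $\ell$ parts, and $\beta=\mathsf{Des}(T')$. There is an index $j$ with $I^-\cup\{i+m\}\subseteq\alpha^{(j)}$. For this $j$ one has $j<\ell$ and $I^+\subseteq\alpha^{(j+1)}$, and $\beta$ is determined as follows (blocks $\alpha^{(r)}$ with $r\le 0$ or $r>\ell$ are omitted). 1. If $T$ is rectangle-free on $[i-1,i+2m]$ and on $[i,i+2m+1]$, then $\beta$ has length $\ell$ and $$\beta=\big(\alpha^{(1)},\dots,\alpha^{(j-1)},\ \alpha^{(j)}\setminus\{i+m\},\ \alpha^{(j+1)}\cup\{i+m\},\ \alpha^{(j+2)},\dots,\alpha^{(\ell)}\big).$$ 2. If $T$ has a rectangle on $[i,i+2m+1]$, then $\beta$ has length $\ell+1$ and $$\beta=\big(\alpha^{(1)},\dots,\alpha^{(j-1)},\ \alpha^{(j)}\setminus\{i+m\},\ I^+\cup\{i+m\},\ \alpha^{(j+1)}\setminus I^+,\ \alpha^{(j+2)},\dots,\alpha^{(\ell)}\big).$$ 3. If $T$ has a rectangle on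 $[i-1,i+2m]$, then $j\ge 2$, $\alpha^{(j)}=I^-\cup\{i+m\}$, $\beta$ has length $\ell-1$ and $$\beta=\big(\alpha^{(1)},\dots,\alpha^{(j-2)},\ \alpha^{(j-1)}\cup I^-,\ \alpha^{(j+1)}\cup\{i+m\},\ \alpha^{(j+2)},\dots,\alpha^{(\ell)}\big).$$ -/

import Mathlib

namespace CrystalSkeleton

/-! Partitions are Young diagrams. The cell `(r, c)` lies in row `r` and column `c`, both counted
from `0`; in French notation row `0` is the bottom row, and a larger `r` means a higher row. -/

/-- Standard Young tableaux of shape `μ`: semistandard tableaux in which each of the letters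
`1, …, |μ|` occurs exactly once. -/
structure StandardTableau (μ : YoungDiagram) extends SemistandardYoungTableau μ where
  bijOn' : Set.BijOn (fun c : ℕ × ℕ => entry c.1 c.2) (μ.cells : Set (ℕ × ℕ))
    (Set.Icc 1 μ.card)

/-- The cells of `μ` in reading order: rows from top to bottom, each row from left to right. -/
def readingCells (μ : YoungDiagram) : List (ℕ × ℕ) :=
  (List.range (μ.colLen 0)).reverse.flatMap fun r =>
    (List.range (μ.rowLen r)).map fun c => (r, c)

/-- The (row) reading word of a tableau. -/
def rowWord {μ : YoungDiagram} (b : SemistandardYoungTableau μ) : List ℕ :=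
  (readingCells μ).map fun c => b c.1 c.2

/-! ### Standardization -/

/-- The cells that are numbered before or together with the cell `(r, c)` by standardization:
smaller letters first, equal letters from left to right. -/
def cellsUpTo {μ : YoungDiagram} (b : SemistandardYoungTableau μ) (r c : ℕ) : Finset (ℕ × ℕ) :=
  μ.cells.filter fun d => b d.1 d.2 < b r c ∨ (b d.1 d.2 = b r c ∧ d.2 ≤ c)

theorem cellsUpTo_ssubset {μ : YoungDiagram} (b : SemistandardYoungTableau μ) {r c r' c' : ℕ}
    (h' : (r', c') ∈ μ) (h : b r c < b r' c' ∨ (b r c = b r' c' ∧ c < c')) :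
    cellsUpTo b r c ⊂ cellsUpTo b r' c' := by
  refine Finset.ssubset_iff_of_subset ?_ |>.2 ⟨(r', c'), ?_, ?_⟩
  · intro d hd
    simp only [cellsUpTo, Finset.mem_filter] at hd ⊢
    refine ⟨hd.1, ?_⟩
    omega
  · simp [cellsUpTo, h']
  · simp only [cellsUpTo, Finset.mem_filter, not_and]
    intro _
    omega

theorem std_injOn {μ : YoungDiagram} (b : SemistandardYoungTableau μ) {r c r' c' : ℕ}
    (h : (r, c) ∈ μ) (h' : (r', c') ∈ μ)
    (e : (cellsUpTo b r c).card = (cellsUpTo b r' c').card) : r = r' ∧ c = c' := by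
  have k1 : ¬ (b r c < b r' c' ∨ (b r c = b r' c' ∧ c < c')) := fun k =>
    absurd (Finset.card_lt_card (cellsUpTo_ssubset b h' k)) (by omega)
  have k2 : ¬ (b r' c' < b r c ∨ (b r' c' = b r c ∧ c' < c)) := fun k =>
    absurd (Finset.card_lt_card (cellsUpTo_ssubset b h k)) (by omega)
  have hc : c = c' := by omega
  subst hc
  refine ⟨?_, rfl⟩
  rcases lt_trichotomy r r' with k | k | k
  · have := b.col_strict k h'
    omega
  · exact k
  · have := b.col_strict k h
    omega

/-- The standardization of a semistandard tableau: the cells are renumbered `1, …, |μ|`,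
smaller letters first and equal letters from left to right. -/
def std {μ : YoungDiagram} (b : SemistandardYoungTableau μ) : StandardTableau μ where
  entry r c := if (r, c) ∈ μ then (cellsUpTo b r c).card else 0
  row_weak' := by
    intro r c c' hc h
    rw [if_pos h, if_pos (μ.up_left_mem le_rfl hc.le h)]
    have := b.row_weak hc h
    exact (Finset.card_lt_card (cellsUpTo_ssubset b h (by omega))).le
  col_strict' := by
    intro r r' c hr h
    rw [if_pos h, if_pos (μ.up_left_mem hr.le le_rfl h)]
    exact Finset.card_lt_card (cellsUpTo_ssubset b h (Or.inl (b.col_strict hr h)))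
  zeros' := fun h => if_neg h
  bijOn' := by
    have hm : ∀ d ∈ μ.cells, (fun d : ℕ × ℕ => if (d.1, d.2) ∈ μ
        then (cellsUpTo b d.1 d.2).card else 0) d ∈ Finset.Icc 1 μ.card := by
      intro d hd
      have hd' : (d.1, d.2) ∈ μ := hd
      simp only [if_pos hd', Finset.mem_Icc]
      exact ⟨Finset.card_pos.2 ⟨d, by simp [cellsUpTo, hd']⟩,
        Finset.card_le_card (Finset.filter_subset _ _)⟩
    have hi : Set.InjOn (fun d : ℕ × ℕ => if (d.1, d.2) ∈ μ
        then (cellsUpTo b d.1 d.2).card else 0) (μ.cells : Set (ℕ × ℕ)) := by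
      intro d hd d' hd' e
      have h1 : (d.1, d.2) ∈ μ := hd
      have h2 : (d'.1, d'.2) ∈ μ := hd'
      simp only [if_pos h1, if_pos h2] at e
      exact Prod.ext_iff.2 (std_injOn b h1 h2 e)
    have hs := Finset.surjOn_of_injOn_of_card_le _ hm hi (by simp [YoungDiagram.card])
    refine ⟨fun d hd => ?_, hi, ?_⟩
    · have := hm d hd
      rwa [← Finset.coe_Icc]
    · rwa [← Finset.coe_Icc]

/-! ### The crystal and its lowering operators -/

/-- The vertices of the crystal `B(μ)_N`: semistandard tableaux over the alphabet `{1, …, N}`. -/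
def crystal (μ : YoungDiagram) (N : ℕ) : Set (SemistandardYoungTableau μ) :=
  {b | ∀ c ∈ μ.cells, 1 ≤ b c.1 c.2 ∧ b c.1 c.2 ≤ N}

/-- The quasi-crystal of `T` inside `B(μ)_N`. -/
def quasiCrystal {μ : YoungDiagram} (N : ℕ) (T : StandardTableau μ) :
    Set (SemistandardYoungTableau μ) :=
  {b | b ∈ crystal μ N ∧ std b = T}

/-- Bracketing of letters `k + 1` with letters `k` to their right. The word is scanned from left
to right; `q` is the position of its first letter and `opened` is the stack of the positions of
the letters `k + 1` seen so far that are not yet bracketed. The result is the list of bracketed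
pairs (position of the `k + 1`, position of the `k`) and the increasing list of the positions of
the unbracketed letters `k`. -/
def bracketScan (k : ℕ) : List ℕ → ℕ → List ℕ → List (ℕ × ℕ) × List ℕ
  | [], _, _ => ([], [])
  | x :: w, q, opened =>
    if x = k + 1 then bracketScan k w (q + 1) (q :: opened)
    else if x = k then
      match opened with
      | [] => ((bracketScan k w (q + 1) []).1, q :: (bracketScan k w (q + 1) []).2)
      | o :: rest => ((o, q) :: (bracketScan k w (q + 1) rest).1, (bracketScan k w (q + 1) rest).2)
    else bracketScan k w (q + 1) opened

/-- The bracketed pairs of positions (of a `k + 1`, of a `k`) in the word `w`. -/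
def bracketedPairs (k : ℕ) (w : List ℕ) : List (ℕ × ℕ) :=
  (bracketScan k w 0 []).1

/-- The position on which `f_k` acts: that of the rightmost unbracketed letter `k`, if any. -/
def loweringPosition (k : ℕ) (w : List ℕ) : Option ℕ :=
  (bracketScan k w 0 []).2.getLast?

/-- The crystal lowering operator `f_k` on words; `none` stands for `∅`. -/
def lowerWord (k : ℕ) (w : List ℕ) : Option (List ℕ) :=
  (loweringPosition k w).map fun p => w.set p (k + 1)

/-- `f_k(b) = b'`, the crystal operator acting on a tableau through its reading word. -/
def Lowers {μ : YoungDiagram} (k : ℕ) (b b' : SemistandardYoungTableau μ) : Prop :=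
  lowerWord k (rowWord b) = some (rowWord b')

/-- The number of bracketed pairs to the left of position `p`. -/
def nLeft (k : ℕ) (w : List ℕ) (p : ℕ) : ℕ :=
  (bracketedPairs k w).countP fun x => decide (x.1 < p ∧ x.2 < p)

/-- The number of bracketed pairs to the right of position `p`. -/
def nRight (k : ℕ) (w : List ℕ) (p : ℕ) : ℕ :=
  (bracketedPairs k w).countP fun x => decide (p < x.1 ∧ p < x.2)

/-! ### Edges of the crystal skeleton -/

/-- `I = [i, i + 2 * m]` is the label of the arrow of the crystal that `f_k` creates at `b`.
Let `f_k` act at position `p` of the reading word of `b`, and let `π` be the reading word of the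
standardization of `b`. The label is
`[π_p - n_left, π_p + n_left + 2 * n_right]`, hence `m = n_left + n_right`. -/
def ArrowLabel {μ : YoungDiagram} (k : ℕ) (b : SemistandardYoungTableau μ) (i m : ℕ) : Prop :=
  ∃ p, loweringPosition k (rowWord b) = some p ∧
    (rowWord (std b).toSemistandardYoungTableau)[p]? = some (i + nLeft k (rowWord b) p) ∧
    m = nLeft k (rowWord b) p + nRight k (rowWord b) p

/-- `T → T'` is an edge of the crystal skeleton of shape `μ` with label `[i, i + 2 * m]`: some
arrow `f_k(b) = b'` of an ambient crystal `B(μ)_N`, `N ≥ |μ|`, leads from the quasi-crystal of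
`T` to that of `T'` and has this label. The condition `0 < m` discards the arrows without
bracketed pairs, which stay inside one quasi-crystal and are contracted. -/
def SkeletonEdge {μ : YoungDiagram} (T T' : StandardTableau μ) (i m : ℕ) : Prop :=
  0 < m ∧ ∃ N, μ.card ≤ N ∧ ∃ b ∈ quasiCrystal N T, ∃ b' ∈ quasiCrystal N T',
    ∃ k, 1 ≤ k ∧ k < N ∧ Lowers k b b' ∧ ArrowLabel k b i m

/-! ### Descent compositions -/

/-- `d` is a descent of `T`: the letter `d + 1` lies in a higher row than the letter `d`. -/
def IsDescent {μ : YoungDiagram} (T : StandardTableau μ) (d : ℕ) : Prop :=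
  ∃ c ∈ μ.cells, ∃ c' ∈ μ.cells,
    T.entry c.1 c.2 = d ∧ T.entry c'.1 c'.2 = d + 1 ∧ c.1 < c'.1

instance {μ : YoungDiagram} (T : StandardTableau μ) (d : ℕ) : Decidable (IsDescent T d) := by
  unfold IsDescent
  infer_instance

/-- The descent composition `(d₁, d₂ - d₁, …, n - d_k)`, given by its partial sums. -/
def Des {μ : YoungDiagram} (T : StandardTableau μ) : Composition μ.card :=
  CompositionAsSet.toComposition
    { boundaries := Finset.univ.filter fun x =>
        x = 0 ∨ x = Fin.last μ.card ∨ IsDescent T (x : ℕ)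
      zero_mem := by simp
      getLast_mem := by simp }

/-- The `j`-th block (`j = 0, 1, …`) of the set partition of `{1, …, n}` into consecutive
intervals that corresponds to the composition `α` of `n`. -/
def block {n : ℕ} (α : Composition n) (j : ℕ) : Finset ℕ :=
  Finset.Ioc (α.sizeUpTo j) (α.sizeUpTo (j + 1))

/-- A composition as the list of the blocks of its set partition. -/
def blockList {n : ℕ} (α : Composition n) : List (Finset ℕ) :=
  (List.range α.length).map (block α)

/-! ### Jeu de taquin -/

/-- A jeu de taquin slide. The filling `S` has the value `0` at the cells without a letter, and
the hole is at `(r, c)`. The smaller one of the letters to the right of the hole and above it (in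
French notation) moves into the hole, until there is no such letter. The first argument bounds
the number of moves. -/
def slide : ℕ → (ℕ × ℕ → ℕ) → ℕ × ℕ → (ℕ × ℕ → ℕ)
  | 0, S, _ => S
  | fuel + 1, S, (r, c) =>
    if S (r, c + 1) = 0 ∧ S (r + 1, c) = 0 then S
    else if S (r + 1, c) = 0 ∨ (S (r, c + 1) ≠ 0 ∧ S (r, c + 1) < S (r + 1, c)) then
      slide fuel (Function.update (Function.update S (r, c) (S (r, c + 1))) (r, c + 1) 0)
        (r, c + 1)
    else
      slide fuel (Function.update (Function.update S (r, c) (S (r + 1, c))) (r + 1, c) 0)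
        (r + 1, c)

/-- The skew tableau `T_{[a, b]}`, with the value `0` at the cells without a letter. -/
def restrict {μ : YoungDiagram} (T : StandardTableau μ) (a b : ℕ) : ℕ × ℕ → ℕ :=
  fun c => if a ≤ T.entry c.1 c.2 ∧ T.entry c.1 c.2 ≤ b then T.entry c.1 c.2 else 0

/-- The cells of the inner shape of `T_{[a, b]}`, in the order in which they contain the letters
`a - 1, a - 2, …, 1` of `T`; each of them is an inner corner once the preceding ones have been
filled. -/
def innerCells {μ : YoungDiagram} (T : StandardTableau μ) (a : ℕ) : List (ℕ × ℕ) :=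
  (List.range a).reverse.flatMap fun x =>
    (readingCells μ).filter fun c => decide (T.entry c.1 c.2 = x)

/-- The jeu de taquin straightening of `T_{[a, b]}`: successive slides into the cells of the
inner shape. (The result does not depend on the order of the slides. A hole moves through
distinct cells of `μ`, so that `|μ|` moves suffice for each slide.) -/
def jdt {μ : YoungDiagram} (T : StandardTableau μ) (a b : ℕ) : ℕ × ℕ → ℕ :=
  (innerCells T a).foldl (slide μ.card) (restrict T a b)

/-- `T` has a rectangle on `[a, b] ⊆ [1, n]`: the interval has an even number `2 * s` of elements
and the straightening of `T_{[a, b]}` has the shape `(s, s)`. Otherwise `T` is rectangle-free on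
`[a, b]`; in particular it is so if `[a, b]` is not contained in `[1, n]`. -/
def HasRectangle {μ : YoungDiagram} (T : StandardTableau μ) (a b : ℕ) : Prop :=
  1 ≤ a ∧ a ≤ b ∧ b ≤ μ.card ∧ ∃ s, b + 1 = a + 2 * s ∧
    ∀ r c : ℕ, jdt T a b (r, c) ≠ 0 ↔ r < 2 ∧ c < s

end CrystalSkeleton

open CrystalSkeleton

/-!
The edge `T → T'` comes from an arrow `f_k(b) = b'`. Everything is read off from the positions of
the letters in the reading words of `T` and `T'`: a letter `d` is a descent exactly when `d + 1` is
read before `d` (`isDescent_iff`).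

Let `p` be the position on which `f_k` acts and `L` the number of bracketed pairs to its left. All
letters `k + 1` before `p` are bracketed with letters `k` before `p`, and all letters `k` after `p`
with letters `k + 1` after `p` (`loweringPosition_spec`). Hence in `T` the letters `[i, i + m]` are
the last letters `k` of `b`, the letters `[i + m + 1, i + 2m]` its first letters `k + 1`, the letter
at `p` is `i + L`, and for each `t ≠ L` one letter of the second group is read before `i + t`. The
tableau `T'` arises from `T` by a cycle on the letters `i + L, …, i + L + m`. The structure
`ArrowPositions` records this (`SkeletonEdge.arrowPositions`). It follows that the descent `i + m`
of `T` becomes the descent `i + m - 1` of `T'`, and that otherwise only `i - 1` may be lost and only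
`i + 2m` may be gained: the first if and only if `L = 0` and `i - 1` is read between `i` and
`i + 1`, the second if and only if `L = m` and `i + 2m + 1` is read between `i + 2m` and `i + m`
(`ArrowPositions.descent_iff`).

These two conditions are the rectangle conditions. A jeu de taquin slide changes neither the
maximal length of an increasing subsequence of the reading word nor the existence of a decreasing
one of length `3` (`slide_spec`; this is checked for each single move of the hole by an exchange
between two adjacent rows). In a straight shape these are the length of the first row and the
existence of a third row. So the straightening of a skew tableau with `2s` letters has shape
`(s, s)` if and only if its reading word has neither a decreasing subsequence of length `3` nor an
increasing one of length `s + 1` (`hasRectangle_iff`), and for the intervals `[i - 1, i + 2m]` and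
`[i, i + 2m + 1]` the word is explicit enough to decide this (`ArrowPositions.rectangle_left_iff`,
`ArrowPositions.rectangle_right_iff`).

Finally, the blocks of a descent composition are the intervals between consecutive elements of the
sorted list of its boundaries `0`, `n` and the descents (`blockList_eq`, `mem_boundaryList_Des`), so
that the change of the descents (`mem_boundaryList_iff`) gives the change of the blocks.
-/

namespace CrystalSkeleton

/-! ### Reading order and its monotone subsequences -/

/-- The cell `x` comes before the cell `y` in the reading order: it lies in a higher row, or in
the same row further to the left. -/
def Before (x y : ℕ × ℕ) : Prop := y.1 < x.1 ∨ (x.1 = y.1 ∧ x.2 < y.2)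

theorem before_or_eq_or_before (x y : ℕ × ℕ) : Before x y ∨ x = y ∨ Before y x := by
  obtain ⟨a, b⟩ := x
  obtain ⟨c, d⟩ := y
  simp only [Before, Prod.mk.injEq]
  omega

theorem Before.trans {x y z : ℕ × ℕ} (h : Before x y) (h' : Before y z) : Before x z := by
  unfold Before at *
  omega

theorem Before.irrefl (x : ℕ × ℕ) : ¬ Before x x := by
  unfold Before
  omega

/-- Some `l` letters of the filling `S` increase in reading order. A filling has the value `0` at
the cells without a letter. -/
def HasIncreasing (S : ℕ × ℕ → ℕ) (l : ℕ) : Prop :=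
  ∃ C : Finset (ℕ × ℕ), C.card = l ∧ (∀ x ∈ C, S x ≠ 0) ∧
    ∀ x ∈ C, ∀ y ∈ C, Before x y → S x < S y

/-- Some three letters of the filling `S` decrease in reading order. -/
def HasDecreasingTriple (S : ℕ × ℕ → ℕ) : Prop :=
  ∃ x y z, S x ≠ 0 ∧ S y ≠ 0 ∧ S z ≠ 0 ∧ Before x y ∧ Before y z ∧ S y < S x ∧ S z < S y

/-- An increasing set of cells is carried to another filling by a map that respects the reading
order and the order of the letters; such a map is injective because the order is total. -/
theorem HasIncreasing.of_map {S' : ℕ × ℕ → ℕ} (C : Finset (ℕ × ℕ)) (f : ℕ × ℕ → ℕ × ℕ)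
    (h0 : ∀ x ∈ C, S' (f x) ≠ 0)
    (h : ∀ x ∈ C, ∀ y ∈ C, Before x y → Before (f x) (f y) ∧ S' (f x) < S' (f y)) :
    HasIncreasing S' C.card := by
  have hi : Set.InjOn f C := by
    intro x hx y hy e
    rcases before_or_eq_or_before x y with k | k | k
    · exact absurd ((h x hx y hy k).1) (e ▸ Before.irrefl _)
    · exact k
    · exact absurd ((h y hy x hx k).1) (e ▸ Before.irrefl _)
  refine ⟨C.image f, Finset.card_image_of_injOn hi, ?_, ?_⟩
  · intro x hx
    obtain ⟨x, hx', rfl⟩ := Finset.mem_image.1 hx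
    exact h0 x hx'
  · intro x hx y hy k
    obtain ⟨x, hx', rfl⟩ := Finset.mem_image.1 hx
    obtain ⟨y, hy', rfl⟩ := Finset.mem_image.1 hy
    rcases before_or_eq_or_before x y with k' | k' | k'
    · exact (h x hx' y hy' k').2
    · exact absurd k (k' ▸ Before.irrefl _)
    · exact absurd (k.trans (h y hy' x hx' k').1) (Before.irrefl _)

/-! ### Jeu de taquin slides -/

/-- The letters of `S` are distinct and increase along rows and columns. -/
def IsStandardFilling (S : ℕ × ℕ → ℕ) : Prop :=
  (∀ r c r' c', S (r, c) ≠ 0 → S (r', c') ≠ 0 → r ≤ r' → c ≤ c' → (r < r' ∨ c < c') →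
    S (r, c) < S (r', c')) ∧
  ∀ r c r' c', S (r, c) ≠ 0 → S (r, c) = S (r', c') → r = r' ∧ c = c'

/-- The cell `(p, q)` is empty in `S`, and together with the letters of `S` it forms a skew shape
(a convex set of cells). -/
def IsHole (S : ℕ × ℕ → ℕ) (p q : ℕ) : Prop :=
  S (p, q) = 0 ∧ ∀ r₁ c₁ r₂ c₂ r₃ c₃, (S (r₁, c₁) ≠ 0 ∨ (r₁ = p ∧ c₁ = q)) →
    (S (r₃, c₃) ≠ 0 ∨ (r₃ = p ∧ c₃ = q)) → r₁ ≤ r₂ → c₁ ≤ c₂ → r₂ ≤ r₃ → c₂ ≤ c₃ →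
    (S (r₂, c₂) ≠ 0 ∨ (r₂ = p ∧ c₂ = q))

/-- The letter at `u` moves to the hole `h`. -/
def move (S : ℕ × ℕ → ℕ) (h u : ℕ × ℕ) : ℕ × ℕ → ℕ :=
  Function.update (Function.update S h (S u)) u 0

theorem move_apply (S : ℕ × ℕ → ℕ) (h u x : ℕ × ℕ) :
    move S h u x = if x = u then 0 else if x = h then S u else S x := by
  simp [move, Function.update_apply]

theorem move_ne_zero_or_iff {S : ℕ × ℕ → ℕ} {p q p' q' : ℕ} (hu : S (p', q') ≠ 0) (a b : ℕ) :
    (move S (p, q) (p', q') (a, b) ≠ 0 ∨ (a = p' ∧ b = q')) ↔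
      (S (a, b) ≠ 0 ∨ (a = p ∧ b = q)) := by
  rw [move_apply]
  simp only [Prod.mk.injEq]
  by_cases h1 : a = p' ∧ b = q'
  · obtain ⟨rfl, rfl⟩ := h1
    simp [hu]
  · rw [if_neg h1]
    by_cases h2 : a = p ∧ b = q
    · rw [if_pos h2]
      exact ⟨fun _ => Or.inr h2, fun _ => Or.inl hu⟩
    · simp [h1, h2]

theorem IsHole.move {S : ℕ × ℕ → ℕ} {p q p' q' : ℕ} (hh : IsHole S p q) (hu : S (p', q') ≠ 0) :
    IsHole (move S (p, q) (p', q')) p' q' := by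
  refine ⟨by simp [move_apply], ?_⟩
  simp only [move_ne_zero_or_iff hu]
  exact hh.2

section up

variable {S : ℕ × ℕ → ℕ} {r c : ℕ}

theorem move_up_standard (hs : IsStandardFilling S) (hh : IsHole S r c)
    (hu : S (r + 1, c) ≠ 0) (hr : S (r, c + 1) ≠ 0 → S (r + 1, c) ≤ S (r, c + 1)) :
    IsStandardFilling (move S (r, c) (r + 1, c)) := by
  have hlt : ∀ c', c < c' → S (r, c') ≠ 0 → S (r + 1, c) < S (r, c') := by
    intro c' hc' h
    have h1 : S (r, c + 1) ≠ 0 := by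
      have := hh.2 r c r (c + 1) r c' (by simp) (Or.inl h)
      omega
    have h2 := hr h1
    have h3 : S (r + 1, c) ≠ S (r, c + 1) := fun e => by
      have := hs.2 _ _ _ _ hu e
      omega
    rcases Nat.lt_or_ge (c + 1) c' with k | k
    · have := hs.1 r (c + 1) r c' h1 h le_rfl k.le (Or.inr k)
      omega
    · have : c' = c + 1 := by omega
      subst this
      omega
  have h0 := hh.1
  constructor
  · intro r1 c1 r2 c2
    simp only [move_apply, Prod.mk.injEq]
    intro n1 n2 hr hc hne
    by_cases a1 : r1 = r + 1 ∧ c1 = c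
    · simp [a1] at n1
    by_cases a2 : r2 = r + 1 ∧ c2 = c
    · simp [a2] at n2
    rw [if_neg a1, if_neg a2] at *
    by_cases b1 : r1 = r ∧ c1 = c
    · have b2 : ¬ (r2 = r ∧ c2 = c) := by omega
      rw [if_pos b1]
      rw [if_neg b2] at *
      rcases Nat.lt_or_ge r r2 with k | k
      · exact hs.1 _ _ _ _ hu n2 (by omega) (by omega) (by omega)
      · have : r2 = r := by omega
        subst this
        exact hlt c2 (by omega) n2
    · rw [if_neg b1] at *
      by_cases b2 : r2 = r ∧ c2 = c
      · rw [if_pos b2]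
        exact hs.1 _ _ _ _ n1 hu (by omega) (by omega) (by omega)
      · rw [if_neg b2] at *
        exact hs.1 _ _ _ _ n1 n2 hr hc hne
  · intro r1 c1 r2 c2
    simp only [move_apply, Prod.mk.injEq]
    have i1 := hs.2 r1 c1 r2 c2
    have i2 := hs.2 (r + 1) c r2 c2
    have i3 := hs.2 r1 c1 (r + 1) c
    split_ifs <;> intros <;> omega

/-- When a letter moves down, the increasing sequence that uses it and letters to the right of it
in its old row continues with the letters below these instead. -/
theorem HasIncreasing.move_up (hs : IsStandardFilling S) (hh : IsHole S r c)
    (hu : S (r + 1, c) ≠ 0) (hs' : IsStandardFilling (move S (r, c) (r + 1, c))) {l : ℕ}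
    (h : HasIncreasing S l) : HasIncreasing (move S (r, c) (r + 1, c)) l := by
  obtain ⟨C, rfl, hC, hi⟩ := h
  have h0 := hh.1
  by_cases huC : (r + 1, c) ∈ C
  swap
  · refine .of_map C id ?_ ?_
    · rintro x hx
      have := hC x hx
      rw [id, move_apply, if_neg (by rintro rfl; exact huC hx),
        if_neg (by rintro rfl; exact this h0)]
      exact this
    · rintro x hx y hy k
      have hx' := hC x hx
      have hy' := hC y hy
      refine ⟨k, ?_⟩
      rw [id, id, move_apply, move_apply, if_neg (by rintro rfl; exact huC hx),
        if_neg (by rintro rfl; exact hx' h0), if_neg (by rintro rfl; exact huC hy),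
        if_neg (by rintro rfl; exact hy' h0)]
      exact hi x hx y hy k
  · have hne : ∀ a b, (a, b) ∈ C → ¬ (a = r + 1 ∧ c ≤ b) →
        move S (r, c) (r + 1, c) (a, b) = S (a, b) := by
      intro a b hab k
      have := hC _ hab
      rw [move_apply, if_neg (by simp only [Prod.mk.injEq]; omega), if_neg]
      rintro ⟨⟩
      exact this h0
    have hmv : ∀ b, c < b → move S (r, c) (r + 1, c) (r, b) = S (r, b) := by
      intro b hb
      rw [move_apply, if_neg (by simp), if_neg (by simp only [Prod.mk.injEq]; omega)]
    have hmh : move S (r, c) (r + 1, c) (r, c) = S (r + 1, c) := by simp [move_apply]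
    have hm0 : ∀ b, (r + 1, b) ∈ C → c ≤ b → move S (r, c) (r + 1, c) (r, b) ≠ 0 ∧
        S (r + 1, c) ≤ move S (r, c) (r + 1, c) (r, b) ∧
        move S (r, c) (r + 1, c) (r, b) ≤ S (r + 1, b) := by
      intro b hb hcb
      rcases hcb.eq_or_lt with rfl | k
      · rw [hmh]
        exact ⟨hu, le_rfl, le_rfl⟩
      · have h1 : S (r, b) ≠ 0 := by
          have := hh.2 r c r b (r + 1) b (by simp) (Or.inl (hC _ hb))
          omega
        have h2 : move S (r, c) (r + 1, c) (r, b) ≠ 0 := by rw [hmv b k]; exact h1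
        have h3 := hs'.1 r c r b (by rw [hmh]; exact hu) h2 le_rfl k.le (Or.inr k)
        have h4 := hs.1 r b (r + 1) b h1 (hC _ hb) (by omega) le_rfl (by omega)
        rw [hmh] at h3
        rw [hmv b k] at *
        exact ⟨h1, h3.le, h4.le⟩
    refine .of_map C (fun x => if x.1 = r + 1 ∧ c ≤ x.2 then (r, x.2) else x) ?_ ?_
    · rintro ⟨a, b⟩ hab
      dsimp only
      split_ifs with k
      · obtain ⟨rfl, k⟩ := k
        exact (hm0 b hab k).1
      · rw [hne a b hab k]
        exact hC _ hab
    · rintro ⟨a, b⟩ hab ⟨a', b'⟩ hab' k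
      have hlt := hi _ hab _ hab' k
      dsimp only
      by_cases k1 : a = r + 1 ∧ c ≤ b <;> by_cases k2 : a' = r + 1 ∧ c ≤ b'
      · rw [if_pos k1, if_pos k2]
        obtain ⟨rfl, k1⟩ := k1
        obtain ⟨rfl, k2⟩ := k2
        simp only [Before, lt_irrefl, true_and, false_or] at k ⊢
        refine ⟨k, hs'.1 _ _ _ _ (hm0 b hab k1).1 (hm0 b' hab' k2).1 le_rfl ?_ ?_⟩ <;> omega
      · rw [if_pos k1, if_neg k2]
        obtain ⟨rfl, k1⟩ := k1
        have h1 := hm0 b hab k1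
        have h2 := hne a' b' hab' k2
        have h3 : ¬ (a' = r ∧ b' ≤ b) := by
          rintro ⟨rfl, k3⟩
          have := hs.1 _ _ _ _ (hC _ hab') (hC _ hab) (by omega) k3 (by omega)
          omega
        simp only [Before] at k ⊢
        omega
      · rw [if_neg k1, if_pos k2]
        obtain ⟨rfl, k2⟩ := k2
        have h1 := hm0 b' hab' k2
        have h2 := hne a b hab k1
        simp only [Before] at k ⊢
        have := hi _ hab _ huC (by simp only [Before]; omega)
        omega
      · rw [if_neg k1, if_neg k2, hne a b hab k1, hne a' b' hab' k2]
        exact ⟨k, hlt⟩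

/-- Converse of `HasIncreasing.move_up`: an increasing sequence that uses the moved letter and
letters to the left of it in its new row passes to the letters above these. -/
theorem HasIncreasing.of_move_up (hs : IsStandardFilling S) (hh : IsHole S r c)
    (hu : S (r + 1, c) ≠ 0) (hs' : IsStandardFilling (move S (r, c) (r + 1, c))) {l : ℕ}
    (h : HasIncreasing (move S (r, c) (r + 1, c)) l) : HasIncreasing S l := by
  obtain ⟨C, rfl, hC, hi⟩ := h
  have hu0 : move S (r, c) (r + 1, c) (r + 1, c) = 0 := by simp [move_apply]
  have hmh : move S (r, c) (r + 1, c) (r, c) = S (r + 1, c) := by simp [move_apply]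
  have hne : ∀ x ∈ C, x ≠ (r, c) → move S (r, c) (r + 1, c) x = S x := by
    intro x hx k
    rw [move_apply, if_neg (by rintro rfl; exact hC _ hx hu0), if_neg k]
  by_cases huC : (r, c) ∈ C
  swap
  · refine .of_map C id ?_ ?_
    · rintro x hx
      rw [id, ← hne x hx (by rintro rfl; exact huC hx)]
      exact hC x hx
    · rintro x hx y hy k
      refine ⟨k, ?_⟩
      rw [id, id, ← hne x hx (by rintro rfl; exact huC hx),
        ← hne y hy (by rintro rfl; exact huC hy)]
      exact hi x hx y hy k
  · have hne' : ∀ a b, (a, b) ∈ C → ¬ (a = r ∧ b ≤ c) →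
        move S (r, c) (r + 1, c) (a, b) = S (a, b) := by
      intro a b hab k
      exact hne _ hab (by simp only [ne_eq, Prod.mk.injEq]; omega)
    have hm0 : ∀ b, (r, b) ∈ C → b ≤ c → S (r + 1, b) ≠ 0 ∧ S (r + 1, b) ≤ S (r + 1, c) ∧
        move S (r, c) (r + 1, c) (r, b) ≤ S (r + 1, b) := by
      intro b hb hbc
      rcases hbc.eq_or_lt with rfl | k
      · rw [hmh]
        exact ⟨hu, le_rfl, le_rfl⟩
      · have h0 := hne _ hb (by simp only [ne_eq, Prod.mk.injEq]; omega)
        have h1 : S (r, b) ≠ 0 := by rw [← h0]; exact hC _ hb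
        have h2 : S (r + 1, b) ≠ 0 := by
          have := hh.2 r b (r + 1) b (r + 1) c (Or.inl h1) (Or.inl hu)
          omega
        have h3 := hs.1 r b (r + 1) b h1 h2 (by omega) le_rfl (by omega)
        have h4 := hs.1 (r + 1) b (r + 1) c h2 hu le_rfl hbc (by omega)
        omega
    refine .of_map C (fun x => if x.1 = r ∧ x.2 ≤ c then (r + 1, x.2) else x) ?_ ?_
    · rintro ⟨a, b⟩ hab
      dsimp only
      split_ifs with k
      · obtain ⟨rfl, k⟩ := k
        exact (hm0 b hab k).1
      · rw [← hne' a b hab k]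
        exact hC _ hab
    · rintro ⟨a, b⟩ hab ⟨a', b'⟩ hab' k
      have hlt := hi _ hab _ hab' k
      dsimp only
      by_cases k1 : a = r ∧ b ≤ c <;> by_cases k2 : a' = r ∧ b' ≤ c
      · rw [if_pos k1, if_pos k2]
        obtain ⟨rfl, k1⟩ := k1
        obtain ⟨rfl, k2⟩ := k2
        simp only [Before, lt_irrefl, true_and, false_or] at k ⊢
        refine ⟨k, hs.1 _ _ _ _ (hm0 b hab k1).1 (hm0 b' hab' k2).1 le_rfl ?_ ?_⟩ <;> omega
      · rw [if_pos k1, if_neg k2]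
        obtain ⟨rfl, k1⟩ := k1
        have h1 := hm0 b hab k1
        have h2 := hne' a' b' hab' k2
        simp only [Before] at k ⊢
        have := hi _ huC _ hab' (by simp only [Before]; omega)
        omega
      · rw [if_neg k1, if_pos k2]
        obtain ⟨rfl, k2⟩ := k2
        have h1 := hm0 b' hab' k2
        have h2 := hne' a b hab k1
        have h3 : ¬ (a = a' + 1 ∧ b' ≤ b) := by
          rintro ⟨rfl, k3⟩
          have := hs'.1 _ _ _ _ (hC _ hab') (hC _ hab) (by omega) k3 (by omega)
          omega
        have h4 : a = a' + 1 → S (a, b) < S (a' + 1, b') := by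
          rintro rfl
          exact hs.1 _ _ _ _ (by rw [← h2]; exact hC _ hab) h1.1 le_rfl (by omega) (by omega)
        simp only [Before] at k ⊢
        omega
      · rw [if_neg k1, if_neg k2, ← hne' a b hab k1, ← hne' a' b' hab' k2]
        exact ⟨k, hlt⟩

/-- When a letter moves down, it stays in the decreasing sequence unless the next letter lies in
the row of the hole; then the letter above that one takes its place. -/
theorem HasDecreasingTriple.move_up (hs : IsStandardFilling S) (hh : IsHole S r c)
    (hu : S (r + 1, c) ≠ 0) (hs' : IsStandardFilling (move S (r, c) (r + 1, c)))
    (h : HasDecreasingTriple S) : HasDecreasingTriple (move S (r, c) (r + 1, c)) := by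
  obtain ⟨x, y, z, nx, ny, nz, bxy, byz, hyx, hzy⟩ := h
  have h0 := hh.1
  have hmh : move S (r, c) (r + 1, c) (r, c) = S (r + 1, c) := by simp [move_apply]
  have hm : ∀ x, S x ≠ 0 → x ≠ (r + 1, c) → move S (r, c) (r + 1, c) x = S x := by
    intro x hx hxu
    rw [move_apply, if_neg hxu, if_neg (by rintro rfl; exact hx h0)]
  -- A letter before the moved one that exceeds it lies above its row.
  have hbig : ∀ a b, S (a, b) ≠ 0 → Before (a, b) (r + 1, c) → S (r + 1, c) < S (a, b) →
      r + 1 < a := by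
    intro a b h1 h2 h3
    simp only [Before] at h2
    by_contra h4
    have : a = r + 1 := by omega
    subst this
    have := hs.1 _ _ _ _ h1 hu le_rfl (by omega) (by omega)
    omega
  -- A later smaller letter in the row of the hole lies below a letter of the row above.
  have hsmall : ∀ b, S (r, b) ≠ 0 → S (r, b) < S (r + 1, c) → b < c ∧ S (r + 1, b) ≠ 0 ∧
      S (r, b) < S (r + 1, b) ∧ S (r + 1, b) < S (r + 1, c) := by
    intro b h1 h2
    have hbc : b ≠ c := by rintro rfl; exact h1 h0
    have h3 : b < c := by
      by_contra h4
      have := hs'.1 r c r b (by rw [hmh]; exact hu) (by rw [hm _ h1 (by simp)]; exact h1)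
        le_rfl (by omega) (by omega)
      rw [hmh, hm _ h1 (by simp)] at this
      omega
    have h4 : S (r + 1, b) ≠ 0 := by
      have := hh.2 r b (r + 1) b (r + 1) c (Or.inl h1) (Or.inl hu)
      omega
    exact ⟨h3, h4, hs.1 _ _ _ _ h1 h4 (by omega) le_rfl (by omega),
      hs.1 _ _ _ _ h4 hu le_rfl (by omega) (by omega)⟩
  obtain ⟨x1, x2⟩ := x
  obtain ⟨y1, y2⟩ := y
  obtain ⟨z1, z2⟩ := z
  by_cases ex : (x1, x2) = (r + 1, c)
  · obtain ⟨rfl, rfl⟩ := Prod.mk.inj ex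
    have ey : (y1, y2) ≠ (r + 1, x2) := fun e => Before.irrefl _ (e ▸ bxy)
    have ez : (z1, z2) ≠ (r + 1, x2) := fun e => Before.irrefl _ (e ▸ bxy.trans byz)
    by_cases k : y1 = r
    · subst k
      obtain ⟨k1, k2, k3, k4⟩ := hsmall y2 ny hyx
      have e := hm (y1 + 1, y2) k2 (by simp only [ne_eq, Prod.mk.injEq]; omega)
      refine ⟨(y1 + 1, y2), (y1, y2), (z1, z2), ?_⟩
      rw [e, hm _ ny ey, hm _ nz ez]
      exact ⟨k2, ny, nz, by simp [Before], byz, k3, hzy⟩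
    · refine ⟨(r, x2), (y1, y2), (z1, z2), ?_⟩
      rw [hmh, hm _ ny ey, hm _ nz ez]
      refine ⟨nx, ny, nz, ?_, byz, hyx, hzy⟩
      have : ¬ (y1 = r + 1 ∧ x2 < y2) := by
        rintro ⟨rfl, k'⟩
        have := hs.1 _ _ _ _ nx ny le_rfl k'.le (by omega)
        omega
      simp only [Before] at bxy ⊢
      omega
  by_cases ey : (y1, y2) = (r + 1, c)
  · obtain ⟨rfl, rfl⟩ := Prod.mk.inj ey
    have ez : (z1, z2) ≠ (r + 1, y2) := fun e => Before.irrefl _ (e ▸ byz)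
    have hx1 := hbig _ _ nx bxy hyx
    by_cases k : z1 = r
    · subst k
      obtain ⟨k1, k2, k3, k4⟩ := hsmall z2 nz hzy
      have e := hm (z1 + 1, z2) k2 (by simp only [ne_eq, Prod.mk.injEq]; omega)
      refine ⟨(x1, x2), (z1 + 1, z2), (z1, z2), ?_⟩
      rw [e, hm _ nx ex, hm _ nz ez]
      refine ⟨nx, k2, nz, ?_, ?_, by omega, k3⟩ <;> simp only [Before] <;> omega
    · refine ⟨(x1, x2), (r, y2), (z1, z2), ?_⟩
      rw [hmh, hm _ nx ex, hm _ nz ez]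
      have : ¬ (z1 = r + 1 ∧ y2 < z2) := by
        rintro ⟨rfl, k'⟩
        have := hs.1 _ _ _ _ ny nz le_rfl k'.le (by omega)
        omega
      refine ⟨nx, ny, nz, ?_, ?_, hyx, hzy⟩ <;> simp only [Before] at byz ⊢ <;> omega
  by_cases ez : (z1, z2) = (r + 1, c)
  · obtain ⟨rfl, rfl⟩ := Prod.mk.inj ez
    have hy1 := hbig _ _ ny byz hzy
    refine ⟨(x1, x2), (y1, y2), (r, z2), ?_⟩
    rw [hmh, hm _ nx ex, hm _ ny ey]
    refine ⟨nx, ny, nz, bxy, ?_, hyx, hzy⟩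
    simp only [Before]
    omega
  · refine ⟨(x1, x2), (y1, y2), (z1, z2), ?_⟩
    rw [hm _ nx ex, hm _ ny ey, hm _ nz ez]
    exact ⟨nx, ny, nz, bxy, byz, hyx, hzy⟩

/-- Converse of `HasDecreasingTriple.move_up`: the moved letter stays in the decreasing sequence
unless the preceding letter lies in its old row; then the letter below that one takes its place. -/
theorem HasDecreasingTriple.of_move_up (hs : IsStandardFilling S) (hh : IsHole S r c)
    (hu : S (r + 1, c) ≠ 0) (hs' : IsStandardFilling (move S (r, c) (r + 1, c)))
    (h : HasDecreasingTriple (move S (r, c) (r + 1, c))) : HasDecreasingTriple S := by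
  obtain ⟨x, y, z, nx, ny, nz, bxy, byz, hyx, hzy⟩ := h
  have h0 := hh.1
  have hu0 : move S (r, c) (r + 1, c) (r + 1, c) = 0 := by simp [move_apply]
  have hmh : move S (r, c) (r + 1, c) (r, c) = S (r + 1, c) := by simp [move_apply]
  have hm : ∀ x, move S (r, c) (r + 1, c) x ≠ 0 → x ≠ (r, c) →
      move S (r, c) (r + 1, c) x = S x := by
    intro x hx hxu
    rw [move_apply, if_neg (by rintro rfl; exact hx hu0), if_neg hxu]
  have nh : move S (r, c) (r + 1, c) (r, c) ≠ 0 := by rw [hmh]; exact hu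
  -- A later letter that is smaller than the moved one lies below its row.
  have hsmall : ∀ a b, move S (r, c) (r + 1, c) (a, b) ≠ 0 → Before (r, c) (a, b) →
      move S (r, c) (r + 1, c) (a, b) < move S (r, c) (r + 1, c) (r, c) → a < r := by
    intro a b h1 h2 h3
    simp only [Before] at h2
    by_contra h4
    have : a = r := by omega
    subst this
    have := hs'.1 _ _ _ _ nh h1 le_rfl (by omega) (by omega)
    omega
  -- An earlier bigger letter in the old row lies above a letter of the new row.
  have hbig : ∀ a b, move S (r, c) (r + 1, c) (a, b) ≠ 0 → Before (a, b) (r, c) →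
      move S (r, c) (r + 1, c) (r, c) < move S (r, c) (r + 1, c) (a, b) → r + 1 < a ∨
      (a = r + 1 ∧ S (r, b) ≠ 0 ∧ S (r, b) < S (a, b) ∧ S (r + 1, c) < S (r, b)) := by
    intro a b h1 h2 h3
    simp only [Before] at h2
    have h4 : a ≠ r := by
      rintro rfl
      have := hs'.1 _ _ _ _ h1 nh le_rfl (by omega) (by omega)
      omega
    by_cases h5 : r + 1 < a
    · exact Or.inl h5
    have h6 : a = r + 1 := by omega
    subst h6
    have e := hm _ h1 (by simp)
    rw [e] at h1
    rw [hmh, e] at h3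
    have h7 : c < b := by
      by_contra h8
      rcases (not_lt.1 h8).eq_or_lt with rfl | h9
      · omega
      · have := hs.1 _ _ _ _ h1 hu le_rfl h9.le (by omega)
        omega
    have h8 : S (r, b) ≠ 0 := by
      have := hh.2 r c r b (r + 1) b (by simp) (Or.inl h1)
      omega
    have e' : move S (r, c) (r + 1, c) (r, b) = S (r, b) := by
      rw [move_apply, if_neg (by simp), if_neg (by simp only [Prod.mk.injEq]; omega)]
    have h9 := hs'.1 r c r b nh (by rw [e']; exact h8) le_rfl h7.le (by omega)
    rw [hmh, e'] at h9
    exact Or.inr ⟨rfl, h8, hs.1 _ _ _ _ h8 h1 (by omega) le_rfl (by omega), h9⟩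
  obtain ⟨x1, x2⟩ := x
  obtain ⟨y1, y2⟩ := y
  obtain ⟨z1, z2⟩ := z
  by_cases ex : (x1, x2) = (r, c)
  · obtain ⟨rfl, rfl⟩ := Prod.mk.inj ex
    have ey : (y1, y2) ≠ (x1, x2) := fun e => Before.irrefl _ (e ▸ bxy)
    have ez : (z1, z2) ≠ (x1, x2) := fun e => Before.irrefl _ (e ▸ bxy.trans byz)
    have k := hsmall _ _ ny bxy hyx
    refine ⟨(x1 + 1, x2), (y1, y2), (z1, z2), ?_⟩
    rw [hmh] at *
    rw [hm _ ny ey] at *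
    rw [hm _ nz ez] at *
    exact ⟨hu, ny, nz, by simp only [Before]; omega, byz, hyx, hzy⟩
  by_cases ey : (y1, y2) = (r, c)
  · obtain ⟨rfl, rfl⟩ := Prod.mk.inj ey
    have ez : (z1, z2) ≠ (y1, y2) := fun e => Before.irrefl _ (e ▸ byz)
    have k := hsmall _ _ nz byz hzy
    have k' := hbig _ _ nx bxy hyx
    rw [hmh] at *
    rw [hm _ nx ex] at *
    rw [hm _ nz ez] at *
    rcases k' with k' | ⟨rfl, k1, k2, k3⟩
    · refine ⟨(x1, x2), (y1 + 1, y2), (z1, z2), nx, hu, nz, ?_, ?_, hyx, hzy⟩ <;>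
        simp only [Before] <;> omega
    · refine ⟨(y1 + 1, x2), (y1, x2), (z1, z2), nx, k1, nz, ?_, ?_, k2, by omega⟩ <;>
        simp only [Before] <;> omega
  by_cases ez : (z1, z2) = (r, c)
  · obtain ⟨rfl, rfl⟩ := Prod.mk.inj ez
    have k' := hbig _ _ ny byz hzy
    rw [hmh] at *
    rw [hm _ nx ex] at *
    rw [hm _ ny ey] at *
    rcases k' with k' | ⟨rfl, k1, k2, k3⟩
    · refine ⟨(x1, x2), (y1, y2), (z1 + 1, z2), nx, ny, hu, bxy, ?_, hyx, hzy⟩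
      simp only [Before]
      omega
    · exact ⟨(x1, x2), (z1 + 1, y2), (z1, y2), nx, ny, k1, bxy, by simp [Before], hyx, k2⟩
  · rw [hm _ nx ex] at *
    rw [hm _ ny ey] at *
    rw [hm _ nz ez] at *
    exact ⟨(x1, x2), (y1, y2), (z1, z2), nx, ny, nz, bxy, byz, hyx, hzy⟩

end up

section right

variable {S : ℕ × ℕ → ℕ} {r c : ℕ}

theorem move_right_standard (hs : IsStandardFilling S) (hh : IsHole S r c)
    (hu : S (r, c + 1) ≠ 0) (hr : S (r + 1, c) ≠ 0 → S (r, c + 1) ≤ S (r + 1, c)) :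
    IsStandardFilling (move S (r, c) (r, c + 1)) := by
  have hlt : ∀ r', r < r' → S (r', c) ≠ 0 → S (r, c + 1) < S (r', c) := by
    intro r' hr' h
    have h1 : S (r + 1, c) ≠ 0 := by
      have := hh.2 r c (r + 1) c r' c (by simp) (Or.inl h)
      omega
    have h2 := hr h1
    have h3 : S (r, c + 1) ≠ S (r + 1, c) := fun e => by
      have := hs.2 _ _ _ _ hu e
      omega
    rcases Nat.lt_or_ge (r + 1) r' with k | k
    · have := hs.1 (r + 1) c r' c h1 h k.le le_rfl (Or.inl k)
      omega
    · have : r' = r + 1 := by omega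
      subst this
      omega
  have h0 := hh.1
  constructor
  · intro r1 c1 r2 c2
    simp only [move_apply, Prod.mk.injEq]
    intro n1 n2 hr hc hne
    by_cases a1 : r1 = r ∧ c1 = c + 1
    · simp [a1] at n1
    by_cases a2 : r2 = r ∧ c2 = c + 1
    · simp [a2] at n2
    rw [if_neg a1, if_neg a2] at *
    by_cases b1 : r1 = r ∧ c1 = c
    · have b2 : ¬ (r2 = r ∧ c2 = c) := by omega
      rw [if_pos b1]
      rw [if_neg b2] at *
      rcases Nat.lt_or_ge c c2 with k | k
      · exact hs.1 _ _ _ _ hu n2 (by omega) (by omega) (by omega)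
      · have : c2 = c := by omega
        subst this
        exact hlt r2 (by omega) n2
    · rw [if_neg b1] at *
      by_cases b2 : r2 = r ∧ c2 = c
      · rw [if_pos b2]
        exact hs.1 _ _ _ _ n1 hu (by omega) (by omega) (by omega)
      · rw [if_neg b2] at *
        exact hs.1 _ _ _ _ n1 n2 hr hc hne
  · intro r1 c1 r2 c2
    simp only [move_apply, Prod.mk.injEq]
    have i1 := hs.2 r1 c1 r2 c2
    have i2 := hs.2 r (c + 1) r2 c2
    have i3 := hs.2 r1 c1 r (c + 1)
    split_ifs <;> intros <;> omega

/-- The position of the moved letter among the other letters in reading order is the same before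
and after a move to the left. -/
theorem before_move_right {x y : ℕ × ℕ} (h0 : S (r, c) = 0) (hx : S x ≠ 0) (hy : S y ≠ 0)
    (h : Before x y) : Before (if x = (r, c + 1) then (r, c) else x)
      (if y = (r, c + 1) then (r, c) else y) := by
  obtain ⟨a, b⟩ := x
  obtain ⟨a', b'⟩ := y
  have h1 : ¬ (a = r ∧ b = c) := by rintro ⟨rfl, rfl⟩; exact hx h0
  have h2 : ¬ (a' = r ∧ b' = c) := by rintro ⟨rfl, rfl⟩; exact hy h0
  simp only [Before, Prod.mk.injEq] at *
  split_ifs <;> simp only <;> omega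

theorem before_of_move_right {x y : ℕ × ℕ} (hx : x ≠ (r, c + 1)) (hy : y ≠ (r, c + 1))
    (h : Before x y) : Before (if x = (r, c) then (r, c + 1) else x)
      (if y = (r, c) then (r, c + 1) else y) := by
  obtain ⟨a, b⟩ := x
  obtain ⟨a', b'⟩ := y
  simp only [Before, Prod.mk.injEq, ne_eq] at *
  split_ifs <;> simp only <;> omega

theorem move_right_apply (hh : IsHole S r c) {x : ℕ × ℕ} (hx : S x ≠ 0) :
    move S (r, c) (r, c + 1) (if x = (r, c + 1) then (r, c) else x) = S x := by
  split_ifs with h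
  · subst h
    simp [move_apply]
  · rw [move_apply, if_neg h, if_neg (by rintro rfl; exact hx hh.1)]

theorem apply_of_move_right {x : ℕ × ℕ} (hx : move S (r, c) (r, c + 1) x ≠ 0) :
    S (if x = (r, c) then (r, c + 1) else x) = move S (r, c) (r, c + 1) x := by
  have h1 : x ≠ (r, c + 1) := by
    rintro rfl
    simp [move_apply] at hx
  rw [move_apply, if_neg h1]
  split_ifs <;> rfl

theorem ne_of_move_right {x : ℕ × ℕ} (hx : move S (r, c) (r, c + 1) x ≠ 0) : x ≠ (r, c + 1) := by
  rintro rfl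
  simp [move_apply] at hx

theorem hasIncreasing_move_right (hh : IsHole S r c) (l : ℕ) :
    HasIncreasing (move S (r, c) (r, c + 1)) l ↔ HasIncreasing S l := by
  constructor
  · rintro ⟨C, rfl, hC, hi⟩
    refine .of_map C (fun x => if x = (r, c) then (r, c + 1) else x) ?_ ?_
    · intro x hx
      rw [apply_of_move_right (hC x hx)]
      exact hC x hx
    · intro x hx y hy k
      rw [apply_of_move_right (hC x hx), apply_of_move_right (hC y hy)]
      exact ⟨before_of_move_right (ne_of_move_right (hC x hx)) (ne_of_move_right (hC y hy)) k,
        hi x hx y hy k⟩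
  · rintro ⟨C, rfl, hC, hi⟩
    refine .of_map C (fun x => if x = (r, c + 1) then (r, c) else x) ?_ ?_
    · intro x hx
      rw [move_right_apply hh (hC x hx)]
      exact hC x hx
    · intro x hx y hy k
      rw [move_right_apply hh (hC x hx), move_right_apply hh (hC y hy)]
      exact ⟨before_move_right hh.1 (hC x hx) (hC y hy) k, hi x hx y hy k⟩

theorem hasDecreasingTriple_move_right (hh : IsHole S r c) :
    HasDecreasingTriple (move S (r, c) (r, c + 1)) ↔ HasDecreasingTriple S := by
  constructor
  · rintro ⟨x, y, z, nx, ny, nz, bxy, byz, hyx, hzy⟩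
    refine ⟨if x = (r, c) then (r, c + 1) else x, if y = (r, c) then (r, c + 1) else y,
      if z = (r, c) then (r, c + 1) else z, ?_⟩
    rw [apply_of_move_right nx, apply_of_move_right ny, apply_of_move_right nz]
    exact ⟨nx, ny, nz, before_of_move_right (ne_of_move_right nx) (ne_of_move_right ny) bxy,
      before_of_move_right (ne_of_move_right ny) (ne_of_move_right nz) byz, hyx, hzy⟩
  · rintro ⟨x, y, z, nx, ny, nz, bxy, byz, hyx, hzy⟩
    refine ⟨if x = (r, c + 1) then (r, c) else x, if y = (r, c + 1) then (r, c) else y,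
      if z = (r, c + 1) then (r, c) else z, ?_⟩
    rw [move_right_apply hh nx, move_right_apply hh ny, move_right_apply hh nz]
    exact ⟨nx, ny, nz, before_move_right hh.1 nx ny bxy, before_move_right hh.1 ny nz byz,
      hyx, hzy⟩

end right

theorem add_lt_card_of_mem {μ : YoungDiagram} {r c : ℕ} (h : (r, c) ∈ μ) : r + c < μ.card := by
  have : (Finset.range (r + c + 1)).card ≤ μ.cells.card := by
    refine Finset.card_le_card_of_injOn (fun t => if t ≤ c then (0, t) else (t - c, c)) ?_ ?_
    · intro t ht
      have ht' : t < r + c + 1 := by simpa using ht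
      dsimp only
      split_ifs with k
      · exact μ.up_left_mem (Nat.zero_le _) k h
      · exact μ.up_left_mem (by omega) le_rfl h
    · intro t _ t' _ e
      dsimp only at e
      split_ifs at e <;> simp only [Prod.mk.injEq] at e <;> omega
  simpa [Nat.succ_le_iff] using this

/-- A slide into a hole of a skew tableau keeps it standard, preserves the increasing and
decreasing sequences of the reading word as far as `HasIncreasing` and `HasDecreasingTriple` see
them, and trades the cell of the hole for a maximal cell `(p, q)`. -/
theorem slide_spec (μ : YoungDiagram) : ∀ (fuel : ℕ) (S : ℕ × ℕ → ℕ) (r c : ℕ),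
    IsStandardFilling S → IsHole S r c → (∀ x, S x ≠ 0 → x ∈ μ) → (r, c) ∈ μ →
    μ.card ≤ fuel + r + c →
    IsStandardFilling (slide fuel S (r, c)) ∧
    (∀ l, HasIncreasing (slide fuel S (r, c)) l ↔ HasIncreasing S l) ∧
    (HasDecreasingTriple (slide fuel S (r, c)) ↔ HasDecreasingTriple S) ∧
    ∃ p q, r ≤ p ∧ c ≤ q ∧ (S (p, q) ≠ 0 ∨ (p = r ∧ q = c)) ∧
      (∀ a b, slide fuel S (r, c) (a, b) ≠ 0 ↔
        (S (a, b) ≠ 0 ∨ (a = r ∧ b = c)) ∧ ¬ (a = p ∧ b = q)) ∧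
      ∀ a b, (S (a, b) ≠ 0 ∨ (a = r ∧ b = c)) → p ≤ a → q ≤ b → a = p ∧ b = q := by
  intro fuel
  induction fuel with
  | zero =>
    intro S r c _ _ _ hm hf
    have := add_lt_card_of_mem hm
    omega
  | succ fuel ih =>
    intro S r c hs hh hS hm hf
    rw [slide]
    by_cases h1 : S (r, c + 1) = 0 ∧ S (r + 1, c) = 0
    · rw [if_pos h1]
      refine ⟨hs, fun _ => Iff.rfl, Iff.rfl, r, c, le_rfl, le_rfl, Or.inr ⟨rfl, rfl⟩, ?_, ?_⟩
      · intro a b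
        have h0 := hh.1
        constructor
        · intro h
          refine ⟨Or.inl h, ?_⟩
          rintro ⟨rfl, rfl⟩
          exact h h0
        · rintro ⟨h | h, h'⟩
          · exact h
          · exact absurd h h'
      · intro a b h ha hb
        by_contra k
        rcases Nat.lt_or_ge r a with k1 | k1
        · have := hh.2 r c (r + 1) c a b (by simp) h
          omega
        · have := hh.2 r c r (c + 1) a b (by simp) h
          omega
    rw [if_neg h1]
    by_cases h2 : S (r + 1, c) = 0 ∨ (S (r, c + 1) ≠ 0 ∧ S (r, c + 1) < S (r + 1, c))
    · rw [if_pos h2]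
      have hu : S (r, c + 1) ≠ 0 := by omega
      change _ ∧ (∀ l, HasIncreasing (slide fuel (move S (r, c) (r, c + 1)) _) l ↔ _) ∧ _
      have hs' := move_right_standard hs hh hu (by omega)
      have key := move_ne_zero_or_iff (p := r) (q := c) hu
      obtain ⟨i1, i2, i3, p, q, hp, hq, i4, i5, i6⟩ := ih (move S (r, c) (r, c + 1)) r (c + 1) hs'
        (hh.move hu) (by
          rintro ⟨a, b⟩ hx
          rcases (key a b).1 (Or.inl hx) with k | ⟨rfl, rfl⟩
          · exact hS _ k
          · exact hm) (hS _ hu) (by omega)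
      simp only [key] at i4 i5 i6
      exact ⟨i1, fun l => (i2 l).trans (hasIncreasing_move_right hh l),
        i3.trans (hasDecreasingTriple_move_right hh), p, q, hp, by omega, i4, i5, i6⟩
    · rw [if_neg h2]
      have hu : S (r + 1, c) ≠ 0 := by omega
      change _ ∧ (∀ l, HasIncreasing (slide fuel (move S (r, c) (r + 1, c)) _) l ↔ _) ∧ _
      have hs' := move_up_standard hs hh hu (by omega)
      have key := move_ne_zero_or_iff (p := r) (q := c) hu
      obtain ⟨i1, i2, i3, p, q, hp, hq, i4, i5, i6⟩ := ih (move S (r, c) (r + 1, c)) (r + 1) c hs'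
        (hh.move hu) (by
          rintro ⟨a, b⟩ hx
          rcases (key a b).1 (Or.inl hx) with k | ⟨rfl, rfl⟩
          · exact hS _ k
          · exact hm) (hS _ hu) (by omega)
      simp only [key] at i4 i5 i6
      exact ⟨i1, fun l => (i2 l).trans
        ⟨.of_move_up hs hh hu hs', .move_up hs hh hu hs'⟩,
        i3.trans ⟨.of_move_up hs hh hu hs', .move_up hs hh hu hs'⟩, p, q, by omega, hq, i4, i5, i6⟩

/-! ### Letters and cells of a standard tableau -/

section standard

variable {μ : YoungDiagram} (T : StandardTableau μ)

theorem entry_eq_zero {r c : ℕ} (h : (r, c) ∉ μ) : T.entry r c = 0 := T.zeros' h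

theorem entry_mem_Icc {r c : ℕ} (h : (r, c) ∈ μ) : 1 ≤ T.entry r c ∧ T.entry r c ≤ μ.card := by
  simpa using T.bijOn'.mapsTo (x := (r, c)) h

theorem entry_inj {r c r' c' : ℕ} (h : (r, c) ∈ μ) (h' : (r', c') ∈ μ)
    (e : T.entry r c = T.entry r' c') : r = r' ∧ c = c' := by
  simpa using T.bijOn'.injOn (x₁ := (r, c)) (x₂ := (r', c')) h h' e

theorem exists_entry_eq {v : ℕ} (h1 : 1 ≤ v) (h2 : v ≤ μ.card) :
    ∃ r c, (r, c) ∈ μ ∧ T.entry r c = v := by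
  obtain ⟨⟨r, c⟩, h, e⟩ := T.bijOn'.surjOn (Set.mem_Icc.2 ⟨h1, h2⟩)
  exact ⟨r, c, h, e⟩

theorem entry_lt {r c r' c' : ℕ} (h : (r', c') ∈ μ) (hr : r ≤ r') (hc : c ≤ c')
    (hne : r < r' ∨ c < c') : T.entry r c < T.entry r' c' := by
  have h1 : (r, c) ∈ μ := μ.up_left_mem hr hc h
  have h2 : T.entry r c ≤ T.entry r c' := by
    rcases hc.eq_or_lt with rfl | k
    · exact le_rfl
    · exact T.row_weak' k (μ.up_left_mem hr le_rfl h)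
  have h3 : T.entry r c' ≤ T.entry r' c' := by
    rcases hr.eq_or_lt with rfl | k
    · exact le_rfl
    · exact (T.col_strict' k h).le
  refine lt_of_le_of_ne (h2.trans h3) fun e => ?_
  have := entry_inj T h1 h e
  omega

theorem mem_readingCells {r c : ℕ} : (r, c) ∈ readingCells μ ↔ (r, c) ∈ μ := by
  simp only [readingCells, List.mem_flatMap, List.mem_reverse, List.mem_range, List.mem_map,
    Prod.mk.injEq]
  constructor
  · rintro ⟨r', _, c', h, rfl, rfl⟩
    exact YoungDiagram.mem_iff_lt_rowLen.2 h
  · intro h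
    refine ⟨r, ?_, c, YoungDiagram.mem_iff_lt_rowLen.1 h, rfl, rfl⟩
    exact YoungDiagram.mem_iff_lt_colLen.1 (μ.up_left_mem le_rfl (Nat.zero_le _) h)

theorem pairwise_readingCells (μ : YoungDiagram) : (readingCells μ).Pairwise Before := by
  rw [readingCells, List.pairwise_flatMap]
  constructor
  · intro r _
    rw [List.pairwise_map]
    exact List.pairwise_lt_range.imp fun h => Or.inr ⟨rfl, h⟩
  · rw [List.pairwise_reverse]
    refine List.pairwise_lt_range.imp fun {a b} h x hx y hy => ?_
    simp only [List.mem_map] at hx hy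
    obtain ⟨_, _, rfl⟩ := hx
    obtain ⟨_, _, rfl⟩ := hy
    exact Or.inl h

theorem nodup_readingCells (μ : YoungDiagram) : (readingCells μ).Nodup :=
  
  List.nodup_iff_pairwise_ne.2 <|
    (pairwise_readingCells μ).imp fun h => by
      rintro rfl
      exact Before.irrefl _ h

theorem filter_readingCells {v : ℕ} {r c : ℕ} (h : (r, c) ∈ μ) (e : T.entry r c = v) :
    (readingCells μ).filter (fun c => decide (T.entry c.1 c.2 = v)) = [(r, c)] := by
  have h1 : (readingCells μ).filter (fun c => decide (T.entry c.1 c.2 = v)) =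
      (readingCells μ).filter (· == (r, c)) := by
    refine List.filter_congr ?_
    rintro ⟨a, b⟩ hab
    have hab' := mem_readingCells.1 hab
    rw [Bool.eq_iff_iff]
    simp only [decide_eq_true_eq, beq_iff_eq, Prod.mk.injEq]
    constructor
    · intro k
      exact entry_inj T hab' h (k.trans e.symm)
    · rintro ⟨rfl, rfl⟩
      exact e
  rw [h1, List.filter_beq,
    List.count_eq_one_of_mem (nodup_readingCells μ) (mem_readingCells.2 h)]
  rfl

/-! ### The straightening and its shape -/

/-- `S` arises from a skew tableau by slides into the cells of `μ` with letters larger than `g` in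
`T`: it is standard with `N` letters, and the letters of `T` that are at most `g` fill its inner
shape. -/
structure IsPartlySlid (g N : ℕ) (S : ℕ × ℕ → ℕ) : Prop where
  standard : IsStandardFilling S
  lt_entry : ∀ r c, S (r, c) ≠ 0 → g < T.entry r c
  inner : ∀ r c r' c', S (r', c') ≠ 0 → r ≤ r' → c ≤ c' → S (r, c) ≠ 0 ∨ T.entry r c ≤ g
  card_eq : (μ.cells.filter fun x => S x ≠ 0).card = N

variable {T}

theorem IsPartlySlid.mem {g N : ℕ} {S : ℕ × ℕ → ℕ} (h : IsPartlySlid T g N S) (x : ℕ × ℕ)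
    (hx : S x ≠ 0) : x ∈ μ := by
  by_contra k
  have := h.lt_entry x.1 x.2 hx
  rw [entry_eq_zero T k] at this
  omega

theorem IsPartlySlid.isHole {g N : ℕ} {S : ℕ × ℕ → ℕ} (h : IsPartlySlid T (g + 1) N S) {p q : ℕ}
    (hm : (p, q) ∈ μ) (e : T.entry p q = g + 1) : IsHole S p q := by
  constructor
  · by_contra k
    have := h.lt_entry _ _ k
    omega
  · intro r1 c1 r2 c2 r3 c3 h1 h3 hr12 hc12 hr23 hc23
    have hm3 : (r3, c3) ∈ μ := by
      rcases h3 with h3 | ⟨rfl, rfl⟩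
      · exact h.mem _ h3
      · exact hm
    have hm2 := μ.up_left_mem hr23 hc23 hm3
    have hT1 : g + 1 ≤ T.entry r1 c1 := by
      rcases h1 with h1 | ⟨rfl, rfl⟩
      · exact (h.lt_entry _ _ h1).le
      · exact e.ge
    have h12 : T.entry r1 c1 ≤ T.entry r2 c2 := by
      by_cases k : r1 < r2 ∨ c1 < c2
      · exact (entry_lt T hm2 hr12 hc12 k).le
      · have e1 : r1 = r2 := by omega
        have e2 : c1 = c2 := by omega
        rw [e1, e2]
    have h23 : S (r2, c2) ≠ 0 ∨ T.entry r2 c2 ≤ g + 1 := by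
      rcases h3 with h3 | ⟨rfl, rfl⟩
      · exact h.inner _ _ _ _ h3 hr23 hc23
      · right
        by_cases k : r2 < r3 ∨ c2 < c3
        · exact (entry_lt T hm3 hr23 hc23 k).le.trans e.le
        · have e1 : r2 = r3 := by omega
          have e2 : c2 = c3 := by omega
          rw [e1, e2, e]
    rcases h23 with k | k
    · exact Or.inl k
    · exact Or.inr (entry_inj T hm2 hm (by omega))

/-- One slide into the cell of the letter `g + 1`. -/
theorem IsPartlySlid.slide {g N : ℕ} {S : ℕ × ℕ → ℕ} (h : IsPartlySlid T (g + 1) N S) {r c : ℕ}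
    (hm : (r, c) ∈ μ) (e : T.entry r c = g + 1) :
    IsPartlySlid T g N (slide μ.card S (r, c)) ∧
      (∀ l, HasIncreasing (CrystalSkeleton.slide μ.card S (r, c)) l ↔ HasIncreasing S l) ∧
      (HasDecreasingTriple (CrystalSkeleton.slide μ.card S (r, c)) ↔ HasDecreasingTriple S) := by
  have hh := h.isHole hm e
  obtain ⟨i1, i2, i3, p, q, hp, hq, i4, i5, i6⟩ := slide_spec μ μ.card S r c h.standard hh
    h.mem hm (by omega)
  refine ⟨⟨i1, ?_, ?_, ?_⟩, i2, i3⟩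
  · intro a b k
    rcases ((i5 a b).1 k).1 with k | ⟨rfl, rfl⟩
    · have := h.lt_entry a b k
      omega
    · omega
  · intro a b a' b' k ha hb
    rw [i5] at k ⊢
    have h1 : (S (a, b) ≠ 0 ∨ (a = r ∧ b = c)) ∨ T.entry a b ≤ g := by
      rcases k.1 with k1 | ⟨rfl, rfl⟩
      · rcases h.inner a b a' b' k1 ha hb with k2 | k2
        · exact Or.inl (Or.inl k2)
        · by_cases k3 : T.entry a b = g + 1
          · exact Or.inl (Or.inr (entry_inj T (μ.up_left_mem ha hb (h.mem _ k1)) hm (by omega)))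
          · right
            omega
      · by_cases k2 : a < a' ∨ b < b'
        · right
          have := entry_lt T hm ha hb k2
          omega
        · left
          right
          omega
    rcases h1 with h1 | h1
    · left
      refine ⟨h1, ?_⟩
      rintro ⟨rfl, rfl⟩
      exact k.2 (i6 a' b' k.1 ha hb)
    · exact Or.inr h1
  · have h1 : (μ.cells.filter fun x => CrystalSkeleton.slide μ.card S (r, c) x ≠ 0) =
        (insert (r, c) (μ.cells.filter fun x => S x ≠ 0)).erase (p, q) := by
      ext ⟨a, b⟩
      simp only [Finset.mem_filter, Finset.mem_erase, Finset.mem_insert, i5, Prod.mk.injEq, ne_eq]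
      constructor
      · rintro ⟨k1, k2 | k2, k3⟩
        · exact ⟨k3, Or.inr ⟨k1, k2⟩⟩
        · exact ⟨k3, Or.inl k2⟩
      · rintro ⟨k1, k2 | k2⟩
        · refine ⟨?_, Or.inr k2, k1⟩
          obtain ⟨rfl, rfl⟩ := k2
          exact hm
        · exact ⟨k2.1, Or.inl k2.2, k1⟩
    rw [h1, Finset.card_erase_of_mem, Finset.card_insert_of_notMem, h.card_eq]
    · rfl
    · simp [hh.1]
    · simp only [Finset.mem_insert, Finset.mem_filter, Prod.mk.injEq]
      rcases i4 with k | k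
      · exact Or.inr ⟨h.mem _ k, k⟩
      · exact Or.inl k

theorem IsPartlySlid.foldl {N : ℕ} : ∀ {g : ℕ} {S : ℕ × ℕ → ℕ}, IsPartlySlid T g N S →
    g ≤ μ.card →
    IsPartlySlid T 0 N ((innerCells T (g + 1)).foldl (CrystalSkeleton.slide μ.card) S) ∧
      (∀ l, HasIncreasing ((innerCells T (g + 1)).foldl (CrystalSkeleton.slide μ.card) S) l ↔
        HasIncreasing S l) ∧
      (HasDecreasingTriple ((innerCells T (g + 1)).foldl (CrystalSkeleton.slide μ.card) S) ↔
        HasDecreasingTriple S) := by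
  intro g
  induction g with
  | zero =>
    intro S h _
    have : innerCells T 1 = [] := by
      simp only [innerCells, List.range_one, List.reverse_singleton, List.flatMap_singleton,
        List.filter_eq_nil_iff]
      rintro ⟨a, b⟩ hab
      have := entry_mem_Icc T (mem_readingCells.1 hab)
      simp only [decide_eq_true_eq]
      omega
    rw [this]
    exact ⟨h, fun _ => Iff.rfl, Iff.rfl⟩
  | succ g ih =>
    intro S h hg
    obtain ⟨r, c, hm, e⟩ := exists_entry_eq T (v := g + 1) (by omega) hg
    have : innerCells T (g + 1 + 1) = (r, c) :: innerCells T (g + 1) := by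
      rw [innerCells, List.range_succ, List.reverse_append, List.reverse_singleton,
        List.singleton_append, List.flatMap_cons, filter_readingCells T hm e]
      rfl
    rw [this, List.foldl_cons]
    obtain ⟨h1, h2, h3⟩ := h.slide hm e
    obtain ⟨k1, k2, k3⟩ := ih h1 (by omega)
    exact ⟨k1, fun l => (k2 l).trans (h2 l), k3.trans h3⟩

theorem restrict_ne_zero {a b r c : ℕ} (ha : 1 ≤ a) :
    restrict T a b (r, c) ≠ 0 ↔ a ≤ T.entry r c ∧ T.entry r c ≤ b := by
  simp only [restrict]
  split_ifs with h <;> omega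

theorem restrict_eq {a b r c : ℕ} (h : restrict T a b (r, c) ≠ 0) :
    restrict T a b (r, c) = T.entry r c := by
  simp only [restrict] at h ⊢
  split_ifs at h ⊢ <;> simp_all

theorem isPartlySlid_restrict {a b : ℕ} (ha : 1 ≤ a) (hb : b ≤ μ.card) :
    IsPartlySlid T (a - 1) (b + 1 - a) (restrict T a b) := by
  have hmem : ∀ r c, restrict T a b (r, c) ≠ 0 → (r, c) ∈ μ := by
    intro r c h
    by_contra k
    rw [restrict_ne_zero ha, entry_eq_zero T k] at h
    omega
  refine ⟨⟨?_, ?_⟩, ?_, ?_, ?_⟩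
  · intro r c r' c' h h' hr hc hne
    rw [restrict_eq h, restrict_eq h']
    exact entry_lt T (hmem _ _ h') hr hc hne
  · intro r c r' c' h e
    have h' : restrict T a b (r', c') ≠ 0 := e ▸ h
    rw [restrict_eq h, restrict_eq h'] at e
    exact entry_inj T (hmem _ _ h) (hmem _ _ h') e
  · intro r c h
    rw [restrict_ne_zero ha] at h
    omega
  · intro r c r' c' h hr hc
    have hm := hmem _ _ h
    rw [restrict_ne_zero ha] at h ⊢
    have : T.entry r c ≤ T.entry r' c' := by
      by_cases k : r < r' ∨ c < c'
      · exact (entry_lt T hm hr hc k).le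
      · have e1 : r = r' := by omega
        have e2 : c = c' := by omega
        rw [e1, e2]
    omega
  · rw [← Nat.card_Icc]
    refine Finset.card_bij (fun x _ => T.entry x.1 x.2) ?_ ?_ ?_
    · rintro ⟨r, c⟩ h
      rw [Finset.mem_filter, restrict_ne_zero ha] at h
      simpa using h.2
    · rintro ⟨r, c⟩ h ⟨r', c'⟩ h' e
      exact Prod.ext_iff.2 (entry_inj T (Finset.mem_filter.1 h).1 (Finset.mem_filter.1 h').1 e)
    · intro v hv
      rw [Finset.mem_Icc] at hv
      obtain ⟨r, c, hm, e⟩ := exists_entry_eq T (v := v) (by omega) (by omega)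
      refine ⟨(r, c), ?_, e⟩
      rw [Finset.mem_filter, restrict_ne_zero ha]
      exact ⟨hm, by omega⟩

/-- The case of Greene's theorem for the shape `(s, s)`: the straightening of a skew tableau with
`2 * s` letters is an `(s, s)` rectangle if and only if its reading word has neither a decreasing
subsequence of length `3` nor an increasing one of length `s + 1`. -/
theorem hasRectangle_iff_restrict {a b s : ℕ} (ha : 1 ≤ a) (hab : a ≤ b) (hb : b ≤ μ.card)
    (hs : b + 1 = a + 2 * s) : HasRectangle T a b ↔
      ¬ HasDecreasingTriple (restrict T a b) ∧ ¬ HasIncreasing (restrict T a b) (s + 1) := by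
  obtain ⟨h1, h2, h3⟩ := (isPartlySlid_restrict (T := T) ha hb).foldl (by omega)
  rw [show a - 1 + 1 = a by omega] at h1 h2 h3
  change IsPartlySlid T 0 (b + 1 - a) (jdt T a b) at h1
  change ∀ l, HasIncreasing (jdt T a b) l ↔ _ at h2
  change HasDecreasingTriple (jdt T a b) ↔ _ at h3
  rw [← h2, ← h3]
  have low : ∀ r c r' c', jdt T a b (r', c') ≠ 0 → r ≤ r' → c ≤ c' → jdt T a b (r, c) ≠ 0 := by
    intro r c r' c' h hr hc
    rcases h1.inner r c r' c' h hr hc with k | k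
    · exact k
    · have hm := μ.up_left_mem hr hc (h1.mem _ h)
      have := entry_mem_Icc T hm
      omega
  constructor
  · rintro ⟨-, -, -, s', hs', hr⟩
    obtain rfl : s' = s := by omega
    constructor
    · rintro ⟨x, y, z, nx, ny, nz, bxy, byz, hyx, hzy⟩
      obtain ⟨x1, x2⟩ := x
      obtain ⟨y1, y2⟩ := y
      obtain ⟨z1, z2⟩ := z
      have r1 : y1 < x1 := by
        simp only [Before] at bxy
        rcases bxy with k | ⟨rfl, k⟩
        · exact k
        · have := h1.standard.1 _ _ _ _ nx ny le_rfl k.le (by omega)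
          omega
      have r2 : z1 < y1 := by
        simp only [Before] at byz
        rcases byz with k | ⟨rfl, k⟩
        · exact k
        · have := h1.standard.1 _ _ _ _ ny nz le_rfl k.le (by omega)
          omega
      have := (hr x1 x2).1 nx
      omega
    · rintro ⟨C, hC, h0, hi⟩
      have : C.card ≤ (Finset.range s').card := by
        refine Finset.card_le_card_of_injOn Prod.snd ?_ ?_
        · rintro ⟨r, c⟩ h
          simpa using ((hr r c).1 (h0 _ h)).2
        · rintro ⟨r, c⟩ h ⟨r', c'⟩ h' e
          obtain rfl : c = c' := e
          rcases Nat.lt_trichotomy r r' with k | rfl | k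
          · have k1 := hi _ h' _ h (Or.inl k)
            have k2 := h1.standard.1 _ _ _ _ (h0 _ h) (h0 _ h') k.le le_rfl (Or.inl k)
            omega
          · rfl
          · have k1 := hi _ h _ h' (Or.inl k)
            have k2 := h1.standard.1 _ _ _ _ (h0 _ h') (h0 _ h) k.le le_rfl (Or.inl k)
            omega
      rw [Finset.card_range] at this
      omega
  · rintro ⟨hd, hi⟩
    refine ⟨ha, hab, hb, s, hs, ?_⟩
    have hrow : ∀ r c, jdt T a b (r, c) ≠ 0 → r < 2 := by
      intro r c h
      by_contra k
      refine hd ⟨(2, c), (1, c), (0, c), low _ _ _ _ h (by omega) le_rfl,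
        low _ _ _ _ h (by omega) le_rfl, low _ _ _ _ h (by omega) le_rfl,
        by simp [Before], by simp [Before], ?_, ?_⟩ <;>
      exact h1.standard.1 _ _ _ _ (low _ _ _ _ h (by omega) le_rfl)
        (low _ _ _ _ h (by omega) le_rfl) (by omega) le_rfl (by omega)
    have hcol : ∀ r c, jdt T a b (r, c) ≠ 0 → c < s := by
      intro r c h
      by_contra k
      refine hi ⟨(Finset.range (s + 1)).image fun t => (0, t), ?_, ?_, ?_⟩
      · rw [Finset.card_image_of_injective _ (fun x y h => (Prod.mk.inj h).2), Finset.card_range]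
      · intro x hx
        obtain ⟨t, ht, rfl⟩ := Finset.mem_image.1 hx
        rw [Finset.mem_range] at ht
        exact low _ _ _ _ h (by omega) (by omega)
      · intro x hx y hy hxy
        obtain ⟨t, ht, rfl⟩ := Finset.mem_image.1 hx
        obtain ⟨t', ht', rfl⟩ := Finset.mem_image.1 hy
        rw [Finset.mem_range] at ht ht'
        have htt : t < t' := by simpa [Before] using hxy
        exact h1.standard.1 _ _ _ _ (low _ _ _ _ h (by omega) (by omega))
          (low _ _ _ _ h (by omega) (by omega)) le_rfl htt.le (Or.inr htt)
    -- The support lies in a rectangle with as many cells as it has.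
    have hsub : (μ.cells.filter fun x => jdt T a b x ≠ 0) ⊆
        Finset.range 2 ×ˢ Finset.range s := by
      rintro ⟨r, c⟩ h
      have := (Finset.mem_filter.1 h).2
      exact Finset.mem_product.2 ⟨Finset.mem_range.2 (hrow r c this),
        Finset.mem_range.2 (hcol r c this)⟩
    have heq := Finset.eq_of_subset_of_card_le hsub (by
      rw [h1.card_eq, Finset.card_product, Finset.card_range, Finset.card_range]
      omega)
    intro r c
    constructor
    · exact fun h => ⟨hrow r c h, hcol r c h⟩
    · intro h
      have : (r, c) ∈ Finset.range 2 ×ˢ Finset.range s :=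
        Finset.mem_product.2 ⟨Finset.mem_range.2 h.1, Finset.mem_range.2 h.2⟩
      rw [← heq] at this
      exact (Finset.mem_filter.1 this).2

end standard

/-! ### Positions of letters in the reading word -/

section position

variable {μ : YoungDiagram} (T : StandardTableau μ)

/-- The position of the letter `v` in the reading word of `T`, counted from `0`. -/
def position (v : ℕ) : ℕ := (rowWord T.toSemistandardYoungTableau).idxOf v

theorem length_readingCells (μ : YoungDiagram) : (readingCells μ).length = μ.card := by
  rw [← List.toFinset_card_of_nodup (nodup_readingCells μ), YoungDiagram.card]
  congr 1
  ext ⟨r, c⟩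
  rw [List.mem_toFinset, mem_readingCells]
  rfl

theorem nodup_rowWord : (rowWord T.toSemistandardYoungTableau).Nodup := by
  refine List.Nodup.map_on ?_ (nodup_readingCells μ)
  rintro ⟨r, c⟩ h ⟨r', c'⟩ h' e
  exact Prod.ext_iff.2 (entry_inj T (mem_readingCells.1 h) (mem_readingCells.1 h') e)

variable {T}

theorem position_of_getElem? {q r c : ℕ} (h : (readingCells μ)[q]? = some (r, c)) :
    position T (T.entry r c) = q := by
  obtain ⟨hq, e⟩ := List.getElem?_eq_some_iff.1 h
  have hq' : q < (rowWord T.toSemistandardYoungTableau).length := by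
    simpa [rowWord] using hq
  have : (rowWord T.toSemistandardYoungTableau)[q] = T.entry r c := by
    simp only [rowWord, List.getElem_map, e]
    rfl
  rw [position, ← this, (nodup_rowWord T).idxOf_getElem]

theorem exists_getElem?_readingCells {r c : ℕ} (h : (r, c) ∈ μ) :
    ∃ q < μ.card, (readingCells μ)[q]? = some (r, c) := by
  obtain ⟨q, hq, e⟩ := List.getElem_of_mem (mem_readingCells.2 h)
  exact ⟨q, length_readingCells μ ▸ hq, List.getElem?_eq_some_iff.2 ⟨hq, e⟩⟩

theorem before_iff_of_getElem? {q q' : ℕ} {x y : ℕ × ℕ} (h : (readingCells μ)[q]? = some x)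
    (h' : (readingCells μ)[q']? = some y) : Before x y ↔ q < q' := by
  obtain ⟨hq, rfl⟩ := List.getElem?_eq_some_iff.1 h
  obtain ⟨hq', rfl⟩ := List.getElem?_eq_some_iff.1 h'
  have := List.pairwise_iff_getElem.1 (pairwise_readingCells μ)
  constructor
  · intro k
    rcases Nat.lt_trichotomy q q' with l | rfl | l
    · exact l
    · exact absurd k (Before.irrefl _)
    · exact absurd (k.trans (this _ _ hq' hq l)) (Before.irrefl _)
  · exact this _ _ hq hq'

theorem before_iff_position {r c r' c' : ℕ} (h : (r, c) ∈ μ) (h' : (r', c') ∈ μ) :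
    Before (r, c) (r', c') ↔ position T (T.entry r c) < position T (T.entry r' c') := by
  obtain ⟨q, _, e⟩ := exists_getElem?_readingCells h
  obtain ⟨q', _, e'⟩ := exists_getElem?_readingCells h'
  rw [position_of_getElem? e, position_of_getElem? e', before_iff_of_getElem? e e']

theorem isDescent_iff {d : ℕ} : IsDescent T d ↔
    1 ≤ d ∧ d + 1 ≤ μ.card ∧ position T (d + 1) < position T d := by
  constructor
  · rintro ⟨⟨r, c⟩, h, ⟨r', c'⟩, h', e, e', k⟩
    dsimp only at e e' k
    have h1 := entry_mem_Icc T h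
    have h2 := entry_mem_Icc T h'
    refine ⟨by omega, by omega, ?_⟩
    rw [← e', ← e, ← before_iff_position h' h]
    exact Or.inl k
  · rintro ⟨h1, h2, k⟩
    obtain ⟨r, c, h, e⟩ := exists_entry_eq T (v := d) h1 (by omega)
    obtain ⟨r', c', h', e'⟩ := exists_entry_eq T (v := d + 1) (by omega) h2
    refine ⟨(r, c), h, (r', c'), h', e, e', ?_⟩
    rw [← e', ← e, ← before_iff_position h' h] at k
    rcases k with k | ⟨k1, k2⟩
    · exact k
    · dsimp only at k1 k2
      subst k1
      have := entry_lt T h le_rfl k2.le (Or.inr k2)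
      omega

/-- The interval `[a, b]` contains letters `u < v < z` that decrease in the reading word. -/
def HasDecreasingLetters (pos : ℕ → ℕ) (a b : ℕ) : Prop :=
  ∃ u v z, a ≤ u ∧ u < v ∧ v < z ∧ z ≤ b ∧ pos z < pos v ∧ pos v < pos u

/-- The interval `[a, b]` contains `l` letters that increase in the reading word. -/
def HasIncreasingLetters (pos : ℕ → ℕ) (a b l : ℕ) : Prop :=
  ∃ X ⊆ Finset.Icc a b, X.card = l ∧ ∀ u ∈ X, ∀ v ∈ X, u < v → pos u < pos v

theorem hasDecreasingTriple_restrict_iff {a b : ℕ} (ha : 1 ≤ a) (hb : b ≤ μ.card) :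
    HasDecreasingTriple (restrict T a b) ↔ HasDecreasingLetters (position T) a b := by
  have hmem : ∀ r c, restrict T a b (r, c) ≠ 0 → (r, c) ∈ μ := fun r c =>
    (isPartlySlid_restrict ha hb).mem (r, c)
  constructor
  · rintro ⟨⟨x1, x2⟩, ⟨y1, y2⟩, ⟨z1, z2⟩, nx, ny, nz, bxy, byz, hyx, hzy⟩
    rw [restrict_eq nx, restrict_eq ny] at hyx
    rw [restrict_eq ny, restrict_eq nz] at hzy
    have mx := hmem _ _ nx
    have my := hmem _ _ ny
    have mz := hmem _ _ nz
    rw [restrict_ne_zero ha] at nx nz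
    exact ⟨_, _, _, nz.1, hzy, hyx, nx.2, (before_iff_position mx my).1 bxy,
      (before_iff_position my mz).1 byz⟩
  · rintro ⟨u, v, z, hu, huv, hvz, hz, h1, h2⟩
    obtain ⟨r1, c1, m1, rfl⟩ := exists_entry_eq T (v := u) (by omega) (by omega)
    obtain ⟨r2, c2, m2, rfl⟩ := exists_entry_eq T (v := v) (by omega) (by omega)
    obtain ⟨r3, c3, m3, rfl⟩ := exists_entry_eq T (v := z) (by omega) (by omega)
    have n1 := (restrict_ne_zero (T := T) (b := b) (r := r1) (c := c1) ha).2 (by omega)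
    have n2 := (restrict_ne_zero (T := T) (b := b) (r := r2) (c := c2) ha).2 (by omega)
    have n3 := (restrict_ne_zero (T := T) (b := b) (r := r3) (c := c3) ha).2 (by omega)
    refine ⟨(r3, c3), (r2, c2), (r1, c1), n3, n2, n1, (before_iff_position m3 m2).2 h1,
      (before_iff_position m2 m1).2 h2, ?_⟩
    rw [restrict_eq n1, restrict_eq n2, restrict_eq n3]
    exact ⟨hvz, huv⟩

theorem hasIncreasing_restrict_iff {a b l : ℕ} (ha : 1 ≤ a) (hb : b ≤ μ.card) :
    HasIncreasing (restrict T a b) l ↔ HasIncreasingLetters (position T) a b l := by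
  have hmem : ∀ r c, restrict T a b (r, c) ≠ 0 → (r, c) ∈ μ := fun r c =>
    (isPartlySlid_restrict ha hb).mem (r, c)
  constructor
  · rintro ⟨C, rfl, h0, hi⟩
    refine ⟨C.image fun x => T.entry x.1 x.2, ?_, Finset.card_image_of_injOn ?_, ?_⟩
    · intro v hv
      obtain ⟨⟨r, c⟩, hx, rfl⟩ := Finset.mem_image.1 hv
      exact Finset.mem_Icc.2 ((restrict_ne_zero ha).1 (h0 _ hx))
    · rintro ⟨r, c⟩ h ⟨r', c'⟩ h' e
      exact Prod.ext_iff.2 (entry_inj T (hmem _ _ (h0 _ h)) (hmem _ _ (h0 _ h')) e)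
    · intro u hu v hv huv
      obtain ⟨⟨r, c⟩, hx, rfl⟩ := Finset.mem_image.1 hu
      obtain ⟨⟨r', c'⟩, hy, rfl⟩ := Finset.mem_image.1 hv
      dsimp only at huv ⊢
      rw [← before_iff_position (hmem _ _ (h0 _ hx)) (hmem _ _ (h0 _ hy))]
      rcases before_or_eq_or_before (r, c) (r', c') with k | k | k
      · exact k
      · obtain ⟨rfl, rfl⟩ := Prod.mk.inj k
        omega
      · have := hi _ hy _ hx k
        rw [restrict_eq (h0 _ hx), restrict_eq (h0 _ hy)] at this
        omega
  · rintro ⟨X, hX, rfl, hi⟩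
    have hXc : ∀ v ∈ X, ∃ x : ℕ × ℕ, x ∈ μ ∧ T.entry x.1 x.2 = v := by
      intro v hv
      have := Finset.mem_Icc.1 (hX hv)
      obtain ⟨r, c, h, e⟩ := exists_entry_eq T (v := v) (by omega) (by omega)
      exact ⟨(r, c), h, e⟩
    choose! f hf hf' using hXc
    have hne : ∀ v ∈ X, restrict T a b (f v) ≠ 0 := fun v hv =>
      (restrict_ne_zero ha).2 (by rw [hf' v hv]; exact Finset.mem_Icc.1 (hX hv))
    have heq : ∀ v ∈ X, restrict T a b (f v) = v := fun v hv =>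
      (restrict_eq (r := (f v).1) (c := (f v).2) (hne v hv)).trans (hf' v hv)
    refine ⟨X.image f, Finset.card_image_of_injOn ?_, ?_, ?_⟩
    · intro u hu v hv e
      rw [← heq u hu, ← heq v hv, e]
    · intro x hx
      obtain ⟨v, hv, rfl⟩ := Finset.mem_image.1 hx
      exact hne v hv
    · intro x hx y hy k
      obtain ⟨u, hu, rfl⟩ := Finset.mem_image.1 hx
      obtain ⟨v, hv, rfl⟩ := Finset.mem_image.1 hy
      rw [heq u hu, heq v hv]
      have k' := (before_iff_position (T := T) (hf u hu) (hf v hv)).1 k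
      rw [hf' u hu, hf' v hv] at k'
      rcases Nat.lt_trichotomy u v with l | rfl | l
      · exact l
      · omega
      · have := hi v hv u hu l
        omega

/-- `hasRectangle_iff_restrict` in terms of the positions of the letters. -/
theorem hasRectangle_iff {a b s : ℕ} (hs : b + 1 = a + 2 * s) (hs0 : 0 < s) :
    HasRectangle T a b ↔ 1 ≤ a ∧ b ≤ μ.card ∧ ¬ HasDecreasingLetters (position T) a b ∧
      ¬ HasIncreasingLetters (position T) a b (s + 1) := by
  by_cases h : 1 ≤ a ∧ b ≤ μ.card
  · rw [hasRectangle_iff_restrict h.1 (by omega) h.2 hs, hasDecreasingTriple_restrict_iff h.1 h.2,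
      hasIncreasing_restrict_iff h.1 h.2]
    tauto
  · constructor
    · rintro ⟨h1, -, h2, -⟩
      exact absurd ⟨h1, h2⟩ h
    · rintro ⟨h1, h2, -⟩
      exact absurd ⟨h1, h2⟩ h

end position

/-! ### The combinatorics of an arrow -/

/-- `pos` and `pos'` are the positions of the letters `1, …, n` in the reading words of two
standard tableaux that are joined by an arrow with label `[i, i + 2 * m]` and `L` bracketed pairs
on the left. The letters `[i, i + m]` stand for the letters `k` of the semistandard tableau (the
last `m + 1` of them), the letters `[i + m + 1, i + 2 * m]` for its letters `k + 1` (the first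
`m`), and `i + L` for the letter on which `f_k` acts. The fields `left` and `right` express the
bracketing on the two sides of that letter, `middle` that exactly `L` letters `k + 1` precede it,
and the last four that the second tableau arises from the first by a cycle of letters. -/
structure ArrowPositions (n i m L : ℕ) (pos pos' : ℕ → ℕ) : Prop where
  m_pos : 0 < m
  i_pos : 1 ≤ i
  le_n : i + 2 * m ≤ n
  le_m : L ≤ m
  inj : ∀ u v, 1 ≤ u → u ≤ n → 1 ≤ v → v ≤ n → pos u = pos v → u = v
  lower : ∀ u v, i ≤ u → u < v → v ≤ i + m → pos u < pos v
  upper : ∀ u v, i + m + 1 ≤ u → u < v → v ≤ i + 2 * m → pos u < pos v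
  left : ∀ t, t < L → pos (i + m + 1 + t) < pos (i + t)
  right : ∀ t, L < t → t ≤ m → pos (i + m + t) < pos (i + t)
  middle : L < m → pos (i + L) < pos (i + m + L + 1)
  pos_of_lt : ∀ v, 1 ≤ v → v < i + L → pos' v = pos v
  pos_of_gt : ∀ v, i + L + m < v → v ≤ n → pos' v = pos v
  pos_shift : ∀ v, i + L ≤ v → v < i + L + m → pos' v = pos (v + 1)
  pos_last : pos' (i + L + m) = pos (i + L)

/-- An increasing set of letters meets a set of letters that decrease in the reading word at most
once. -/
theorem HasIncreasingLetters.le_of_decreasing_fibers {pos : ℕ → ℕ} {a b l N : ℕ}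
    (h : HasIncreasingLetters pos a b l) (g : ℕ → ℕ) (hg : ∀ v, a ≤ v → v ≤ b → g v < N)
    (hp : ∀ u v, a ≤ u → u < v → v ≤ b → g u = g v → pos v < pos u) : l ≤ N := by
  obtain ⟨X, hX, rfl, hi⟩ := h
  have : X.card ≤ (Finset.range N).card := by
    refine Finset.card_le_card_of_injOn g ?_ ?_
    · intro v hv
      have := Finset.mem_Icc.1 (hX hv)
      simpa using hg v this.1 this.2
    · intro u hu v hv e
      have h1 := Finset.mem_Icc.1 (hX hu)
      have h2 := Finset.mem_Icc.1 (hX hv)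
      rcases Nat.lt_trichotomy u v with k | k | k
      · have k1 := hi u hu v hv k
        have k2 := hp u v h1.1 k h2.2 e
        omega
      · exact k
      · have k1 := hi v hv u hu k
        have k2 := hp v u h2.1 k h1.2 e.symm
        omega
  simpa using this

namespace ArrowPositions

variable {n i m L : ℕ} {pos pos' : ℕ → ℕ}

/-- The letters `[i - 1, i + 2 * m]` form a rectangle if and only if `i` is the letter on which
`f_k` acts and `i - 1` is read after `i` and before `i + 1`. -/
theorem rectangle_left_iff (h : ArrowPositions n i m L pos pos') (hi : 1 ≤ i - 1) :
    (¬ HasDecreasingLetters pos (i - 1) (i + 2 * m) ∧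
      ¬ HasIncreasingLetters pos (i - 1) (i + 2 * m) (m + 2)) ↔
    L = 0 ∧ pos i < pos (i - 1) ∧ pos (i - 1) < pos (i + 1) := by
  have hm := h.m_pos
  have hn := h.le_n
  constructor
  · rintro ⟨hd, hinc⟩
    have h1 : pos i < pos (i - 1) := by
      by_contra k
      have k' : pos (i - 1) < pos i := by
        refine lt_of_le_of_ne (not_lt.1 k) fun e => ?_
        have := h.inj (i - 1) i hi (by omega) (by omega) (by omega) e
        omega
      refine hinc ⟨Finset.Icc (i - 1) (i + m), ?_, ?_, ?_⟩
      · exact Finset.Icc_subset_Icc le_rfl (by omega)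
      · rw [Nat.card_Icc]
        omega
      · intro u hu v hv huv
        rw [Finset.mem_Icc] at hu hv
        rcases Nat.lt_or_ge u i with k1 | k1
        · obtain rfl : u = i - 1 := by omega
          rcases Nat.lt_or_ge i v with k2 | k2
          · have := h.lower i v le_rfl k2 hv.2
            omega
          · obtain rfl : v = i := by omega
            exact k'
        · exact h.lower u v k1 huv hv.2
    have h2 : L = 0 := by
      by_contra k
      have := h.left 0 (by omega)
      exact hd ⟨i - 1, i, i + m + 1, by omega, by omega, by omega, by omega,
        by simpa using this, h1⟩
    refine ⟨h2, h1, ?_⟩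
    by_contra k
    have k' : pos (i + 1) < pos (i - 1) := by
      refine lt_of_le_of_ne (not_lt.1 k) fun e => ?_
      have := h.inj (i + 1) (i - 1) (by omega) (by omega) (by omega) (by omega) e
      omega
    have := h.right 1 (by omega) hm
    exact hd ⟨i - 1, i + 1, i + m + 1, by omega, by omega, by omega, by omega, this, k'⟩
  · rintro ⟨rfl, h1, h2⟩
    have hmid : pos i < pos (i + m + 1) := h.middle hm
    constructor
    · rintro ⟨u, v, z, hu, huv, hvz, hz, k1, k2⟩
      have hv : v ≤ i + m := by
        by_contra k
        have := h.upper v z (by omega) hvz hz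
        omega
      have hu' : u = i - 1 := by
        by_contra k
        have := h.lower u v (by omega) huv hv
        omega
      subst hu'
      have hv' : v = i := by
        by_contra k
        rcases Nat.lt_or_ge (i + 1) v with k3 | k3
        · have := h.lower (i + 1) v (by omega) k3 hv
          omega
        · obtain rfl : v = i + 1 := by omega
          omega
      subst hv'
      rcases Nat.lt_or_ge (v + m) z with k3 | k3
      · rcases Nat.lt_or_ge (v + m + 1) z with k4 | k4
        · have := h.upper (v + m + 1) z le_rfl k4 hz
          omega
        · obtain rfl : z = v + m + 1 := by omega
          omega
      · have := h.lower v z le_rfl hvz k3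
        omega
    · -- The `m + 1` pairs `{i - 1, i}` and `{i + t, i + m + t}` are decreasing.
      intro hinc
      have := hinc.le_of_decreasing_fibers (N := m + 1)
        (fun v => if v ≤ i then 0 else if v ≤ i + m then v - i else v - (i + m)) (by
          intro v hv hv'
          split_ifs <;> omega) (by
          intro u v hu huv hv e
          have k1 : u = i - 1 ∧ v = i ∨ ∃ t, 0 < t ∧ t ≤ m ∧ u = i + t ∧ v = i + m + t := by
            by_cases k : v ≤ i
            · left
              omega
            · refine Or.inr ⟨v - (i + m), ?_⟩
              split_ifs at e <;> omega
          rcases k1 with ⟨rfl, rfl⟩ | ⟨t, k1, k2, rfl, rfl⟩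
          · exact h1
          · exact h.right t k1 k2)
      omega

/-- The letters `[i, i + 2 * m + 1]` form a rectangle if and only if `i + m` is the letter on which
`f_k` acts and `i + 2 * m + 1` is read after `i + 2 * m` and before `i + m`. -/
theorem rectangle_right_iff (h : ArrowPositions n i m L pos pos') (hn : i + 2 * m + 1 ≤ n) :
    (¬ HasDecreasingLetters pos i (i + 2 * m + 1) ∧
      ¬ HasIncreasingLetters pos i (i + 2 * m + 1) (m + 2)) ↔
    L = m ∧ pos (i + 2 * m) < pos (i + 2 * m + 1) ∧ pos (i + 2 * m + 1) < pos (i + m) := by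
  have hm := h.m_pos
  have hi := h.i_pos
  have hL := h.le_m
  have hlast : pos (i + 2 * m) < pos (i + m) := by
    rcases hL.eq_or_lt with rfl | k
    · have k1 := h.left (L - 1) (by omega)
      have k2 := h.lower (i + (L - 1)) (i + L) (by omega) (by omega) (by omega)
      rw [show i + L + 1 + (L - 1) = i + 2 * L by omega] at k1
      omega
    · have k1 := h.right m k le_rfl
      rwa [show i + m + m = i + 2 * m by omega] at k1
  constructor
  · rintro ⟨hd, hinc⟩
    have h1 : pos (i + 2 * m) < pos (i + 2 * m + 1) := by
      by_contra k
      have k' : pos (i + 2 * m + 1) < pos (i + 2 * m) := by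
        refine lt_of_le_of_ne (not_lt.1 k) fun e => ?_
        have := h.inj _ _ (by omega) (by omega) (by omega) (by omega) e
        omega
      exact hd ⟨i + m, i + 2 * m, i + 2 * m + 1, by omega, by omega, by omega, le_rfl, k', hlast⟩
    have h2 : ¬ pos (i + L) < pos (i + m + L + 1) := by
      intro k
      refine hinc ⟨Finset.Icc i (i + L) ∪ Finset.Icc (i + m + L + 1) (i + 2 * m + 1), ?_, ?_, ?_⟩
      · refine Finset.union_subset (Finset.Icc_subset_Icc le_rfl (by omega))
          (Finset.Icc_subset_Icc (by omega) le_rfl)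
      · rw [Finset.card_union_of_disjoint, Nat.card_Icc, Nat.card_Icc]
        · omega
        · rw [Finset.disjoint_left]
          intro u hu hu'
          rw [Finset.mem_Icc] at hu hu'
          omega
      · have hup : ∀ u v, i + m + 1 ≤ u → u < v → v ≤ i + 2 * m + 1 → pos u < pos v := by
          intro u v hu huv hv
          rcases Nat.lt_or_ge (i + 2 * m) v with k1 | k1
          · obtain rfl : v = i + 2 * m + 1 := by omega
            rcases Nat.lt_or_ge u (i + 2 * m) with k2 | k2
            · have := h.upper u (i + 2 * m) hu k2 le_rfl
              omega
            · obtain rfl : u = i + 2 * m := by omega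
              exact h1
          · exact h.upper u v hu huv k1
        intro u hu v hv huv
        rw [Finset.mem_union, Finset.mem_Icc, Finset.mem_Icc] at hu hv
        rcases Nat.lt_or_ge (i + m) u with k1 | k1
        · exact hup u v k1 huv (by omega)
        rcases Nat.lt_or_ge (i + m) v with k2 | k2
        · have k3 : pos u ≤ pos (i + L) := by
            rcases Nat.lt_or_ge u (i + L) with k3 | k3
            · exact (h.lower u _ (by omega) k3 (by omega)).le
            · obtain rfl : u = i + L := by omega
              exact le_rfl
          have k4 : pos (i + m + L + 1) ≤ pos v := by
            rcases Nat.lt_or_ge (i + m + L + 1) v with k3 | k3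
            · exact (hup _ v (by omega) k3 (by omega)).le
            · obtain rfl : v = i + m + L + 1 := by omega
              exact le_rfl
          omega
        · exact h.lower u v (by omega) huv k2
    have h3 : L = m := by
      by_contra k
      exact h2 (h.middle (by omega))
    subst h3
    refine ⟨rfl, h1, ?_⟩
    rw [show i + L + L + 1 = i + 2 * L + 1 by omega] at h2
    refine lt_of_le_of_ne (not_lt.1 h2) fun e => ?_
    have := h.inj _ _ (by omega) (by omega) (by omega) (by omega) e
    omega
  · rintro ⟨rfl, h1, h2⟩
    constructor
    · rintro ⟨u, v, z, hu, huv, hvz, hz, k1, k2⟩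
      have hv : i + L < v := by
        by_contra k
        have := h.lower u v hu huv (by omega)
        omega
      rcases Nat.lt_or_ge (i + 2 * L) z with k3 | k3
      · obtain rfl : z = i + 2 * L + 1 := by omega
        rcases Nat.lt_or_ge v (i + 2 * L) with k4 | k4
        · have := h.upper v _ hv k4 le_rfl
          omega
        · obtain rfl : v = i + 2 * L := by omega
          omega
      · have := h.upper v z hv hvz k3
        omega
    · -- The `m + 1` pairs `{i + t, i + m + 1 + t}` are decreasing.
      intro hinc
      have := hinc.le_of_decreasing_fibers (N := L + 1)
        (fun v => if v ≤ i + L then v - i else v - (i + L + 1)) (by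
          intro v hv hv'
          split_ifs <;> omega) (by
          intro u v hu huv hv e
          obtain ⟨t, k1, rfl, rfl⟩ : ∃ t, t ≤ L ∧ u = i + t ∧ v = i + L + 1 + t := by
            refine ⟨v - (i + L + 1), ?_⟩
            split_ifs at e <;> omega
          rcases k1.eq_or_lt with rfl | k1
          · rw [show i + t + 1 + t = i + 2 * t + 1 by omega]
            exact h2
          · exact h.left t k1)
      omega

/-- The descents of the target of an arrow. -/
theorem descent_iff (h : ArrowPositions n i m L pos pos') {d : ℕ} (hd : 1 ≤ d) (hdn : d + 1 ≤ n) :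
    pos' (d + 1) < pos' d ↔
      (pos (d + 1) < pos d ∧ d ≠ i + m ∧
        ¬ (d + 1 = i ∧ L = 0 ∧ pos (i - 1) < pos (i + 1))) ∨
      d + 1 = i + m ∨ (d = i + 2 * m ∧ L = m ∧ pos (i + 2 * m + 1) < pos (i + m)) := by
  have hm := h.m_pos
  have hi := h.i_pos
  have hL := h.le_m
  have hn := h.le_n
  rcases Nat.lt_or_ge (d + 1) i with k1 | k1
  · rw [h.pos_of_lt d hd (by omega), h.pos_of_lt (d + 1) (by omega) (by omega)]
    omega
  rcases Nat.lt_or_ge (i + 2 * m) d with k2 | k2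
  · rw [h.pos_of_gt d (by omega) (by omega), h.pos_of_gt (d + 1) (by omega) (by omega)]
    omega
  rcases k1.eq_or_lt with k3 | k3
  · subst k3
    rw [h.pos_of_lt d hd (by omega)]
    rcases Nat.eq_zero_or_pos L with rfl | k4
    · rw [h.pos_shift (d + 1) (by omega) (by omega)]
      have e1 := h.lower (d + 1) (d + 1 + 1) le_rfl (by omega) (by omega)
      have e2 : pos d ≠ pos (d + 1 + 1) := fun e => by
        have := h.inj _ _ (by omega) (by omega) (by omega) (by omega) e
        omega
      simp only [Nat.add_sub_cancel, true_and]
      omega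
    · rw [h.pos_of_lt (d + 1) (by omega) (by omega)]
      omega
  rcases Nat.lt_or_ge (d + 1) (i + m) with k4 | k4
  · have e1 := h.lower d (d + 1) (by omega) (by omega) (by omega)
    have e2 : pos' d < pos' (d + 1) := by
      rcases Nat.lt_or_ge (d + 1) (i + L) with k5 | k5
      · rw [h.pos_of_lt d hd (by omega), h.pos_of_lt (d + 1) (by omega) k5]
        exact e1
      · rw [h.pos_shift (d + 1) k5 (by omega)]
        rcases Nat.lt_or_ge d (i + L) with k6 | k6
        · rw [h.pos_of_lt d hd k6]
          exact h.lower _ _ (by omega) (by omega) (by omega)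
        · rw [h.pos_shift d k6 (by omega)]
          exact h.lower _ _ (by omega) (by omega) (by omega)
    omega
  rcases k4.eq_or_lt with k5 | k5
  · have e2 : pos' (d + 1) < pos' d := by
      obtain rfl : d = i + m - 1 := by omega
      rw [← k5]
      rcases Nat.eq_zero_or_pos L with rfl | k6
      · have k7 : pos' (i + m) = pos i := h.pos_last
        rw [k7, h.pos_shift _ (by omega) (by omega), ← k5]
        exact h.lower _ _ le_rfl (by omega) le_rfl
      · have k8 := h.left 0 k6
        rw [h.pos_shift _ (by omega) (by omega)]
        rcases hL.eq_or_lt with rfl | k7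
        · rw [h.pos_of_lt _ (by omega) (by omega)]
          rcases Nat.lt_or_ge 1 L with k9 | k9
          · have := h.lower (i + 0) (i + L - 1) (by omega) (by omega) (by omega)
            exact k8.trans this
          · obtain rfl : L = 1 := by omega
            exact k8
        · rw [h.pos_shift _ (by omega) (by omega), ← k5]
          exact k8.trans (h.lower _ _ (by omega) (by omega) le_rfl)
    omega
  rcases Nat.lt_or_ge (i + m) d with k6 | k6
  swap
  · obtain rfl : d = i + m := by omega
    have e2 : pos' (i + m) < pos' (i + m + 1) := by
      rcases Nat.eq_zero_or_pos L with rfl | k6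
      · have k7 : pos' (i + m) = pos i := h.pos_last
        rw [k7, h.pos_of_gt _ (by omega) (by omega)]
        exact h.middle hm
      · rw [h.pos_shift (i + m) (by omega) (by omega)]
        rcases Nat.lt_or_ge 1 L with k7 | k7
        · rw [h.pos_shift _ (by omega) (by omega)]
          exact h.upper _ _ le_rfl (by omega) (by omega)
        · obtain rfl : L = 1 := by omega
          have k8 : pos' (i + m + 1) = pos (i + 1) := by
            rw [← h.pos_last]
            congr 1
            omega
          rw [k8]
          exact (h.left 0 (by omega)).trans (h.lower _ _ (by omega) (by omega) (by omega))
    omega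
  rcases Nat.lt_or_ge d (i + 2 * m) with k7 | k7
  · have e1 := h.upper d (d + 1) (by omega) (by omega) (by omega)
    have e2 : pos' d < pos' (d + 1) := by
      rcases Nat.lt_trichotomy (d + 1) (i + L + m) with k8 | k8 | k8
      · rw [h.pos_shift d (by omega) (by omega), h.pos_shift (d + 1) (by omega) (by omega)]
        exact h.upper _ _ (by omega) (by omega) (by omega)
      · rw [h.pos_shift d (by omega) (by omega), k8, h.pos_last]
        have k9 := h.left (L - 1) (by omega)
        rw [show i + m + 1 + (L - 1) = i + L + m by omega] at k9
        exact k9.trans (h.lower _ _ (by omega) (by omega) (by omega))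
      · rw [h.pos_of_gt (d + 1) k8 (by omega)]
        rcases Nat.lt_or_ge (i + L + m) d with k9 | k9
        · rw [h.pos_of_gt d k9 (by omega)]
          exact e1
        · obtain rfl : d = i + L + m := by omega
          rw [h.pos_last]
          have k10 := h.middle (by omega)
          rwa [show i + m + L + 1 = i + L + m + 1 by omega] at k10
    omega
  obtain rfl : d = i + 2 * m := by omega
  rcases hL.eq_or_lt with rfl | k8
  · have k9 : pos' (i + 2 * L) = pos (i + L) := by
      rw [← h.pos_last]
      congr 1
      omega
    have k10 := h.left (L - 1) (by omega)
    have k11 := h.lower (i + (L - 1)) (i + L) (by omega) (by omega) (by omega)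
    rw [show i + L + 1 + (L - 1) = i + 2 * L by omega] at k10
    rw [k9, h.pos_of_gt _ (by omega) hdn]
    omega
  · rw [h.pos_of_gt _ (by omega) hn, h.pos_of_gt _ (by omega) hdn]
    omega

end ArrowPositions

/-! ### Bracketing -/

/-- The positions of the letters `k + 1` that are still open after a scan. -/
def bracketStack (k : ℕ) : List ℕ → ℕ → List ℕ → List ℕ
  | [], _, opened => opened
  | x :: w, q, opened =>
    if x = k + 1 then bracketStack k w (q + 1) (q :: opened)
    else if x = k then bracketStack k w (q + 1) opened.tail
    else bracketStack k w (q + 1) opened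

theorem bracketStack_append (k : ℕ) (u v : List ℕ) : ∀ q opened,
    bracketStack k (u ++ v) q opened =
      bracketStack k v (q + u.length) (bracketStack k u q opened) := by
  induction u with
  | nil => intro q opened; rfl
  | cons x u ih =>
    intro q opened
    simp only [List.cons_append, bracketStack, List.length_cons, ih]
    split_ifs <;> congr 1 <;> omega

theorem bracketScan_append (k : ℕ) (u v : List ℕ) : ∀ q opened,
    bracketScan k (u ++ v) q opened =
      ((bracketScan k u q opened).1 ++
          (bracketScan k v (q + u.length) (bracketStack k u q opened)).1,
        (bracketScan k u q opened).2 ++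
          (bracketScan k v (q + u.length) (bracketStack k u q opened)).2) := by
  induction u with
  | nil => intro q opened; rfl
  | cons x u ih =>
    intro q opened
    have e : q + (x :: u).length = q + 1 + u.length := by
      simp only [List.length_cons]
      omega
    rw [List.cons_append, e]
    rcases opened with _ | ⟨o, rest⟩ <;> by_cases h1 : x = k + 1 <;> by_cases h2 : x = k <;>
      simp [bracketScan, bracketStack, ih, h1, h2]

/-- Every `k` is bracketed or unbracketed; every `k + 1` is bracketed or remains open. -/
theorem length_bracketScan (k : ℕ) (w : List ℕ) : ∀ q opened,
    (bracketScan k w q opened).1.length + (bracketScan k w q opened).2.length = w.count k ∧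
    (bracketStack k w q opened).length + (bracketScan k w q opened).1.length =
      opened.length + w.count (k + 1) := by
  induction w with
  | nil => intro q opened; simp [bracketScan, bracketStack]
  | cons x w ih =>
    intro q opened
    rw [List.count_cons, List.count_cons]
    by_cases h1 : x = k + 1
    · have := ih (q + 1) (q :: opened)
      simp only [bracketScan, bracketStack, h1, if_true, List.length_cons] at this ⊢
      simp
      omega
    by_cases h2 : x = k
    · rcases opened with _ | ⟨o, rest⟩
      · have := ih (q + 1) []
        simp [bracketScan, bracketStack, h2] at this ⊢
        omega
      · have := ih (q + 1) rest
        simp [bracketScan, bracketStack, h2] at this ⊢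
        omega
    · have := ih (q + 1) opened
      simpa [bracketScan, bracketStack, h1, h2] using this

/-- A bracketed pair consists of positions of the scanned word, except that its `k + 1` may be one
of the letters that were open at the start. -/
theorem mem_bracketScan (k : ℕ) (w : List ℕ) : ∀ q opened, ∀ x ∈ (bracketScan k w q opened).1,
    (x.1 ∈ opened ∨ (q ≤ x.1 ∧ x.1 < q + w.length)) ∧ q ≤ x.2 ∧ x.2 < q + w.length := by
  induction w with
  | nil => intro q opened; simp [bracketScan]
  | cons y w ih =>
    intro q opened x hx
    rw [List.length_cons]
    by_cases h1 : y = k + 1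
    · simp only [bracketScan, h1, if_true] at hx
      have := ih _ _ x hx
      rw [List.mem_cons] at this
      grind
    by_cases h2 : y = k
    · rcases opened with _ | ⟨o, rest⟩
      · simp only [bracketScan, h2, if_true, Nat.left_eq_add, one_ne_zero, if_false] at hx
        have := ih _ _ x hx
        grind
      · simp only [bracketScan, h2, if_true, Nat.left_eq_add, one_ne_zero, if_false,
          List.mem_cons] at hx
        rw [List.mem_cons]
        rcases hx with rfl | hx
        · simp
        · have := ih _ _ x hx
          grind
    · simp only [bracketScan, h1, h2, if_false] at hx
      have := ih _ _ x hx
      grind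

/-- The rightmost unbracketed `k` cuts the word in two parts: all letters `k + 1` of the first one
are bracketed inside it, and so are all letters `k` of the second one. -/
theorem exists_split_of_getLast? (k : ℕ) (w : List ℕ) : ∀ q opened p,
    (bracketScan k w q opened).2.getLast? = some p → ∃ u v, w = u ++ k :: v ∧ p = q + u.length ∧
      bracketStack k u q opened = [] ∧ (bracketScan k v (p + 1) []).2 = [] := by
  induction w with
  | nil => intro q opened p h; simp [bracketScan] at h
  | cons x w ih =>
    intro q opened p h
    by_cases h1 : x = k + 1
    · simp only [bracketScan, h1, if_true] at h
      obtain ⟨u, v, rfl, rfl, h3, h4⟩ := ih _ _ _ h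
      refine ⟨x :: u, v, rfl, by simp only [List.length_cons]; omega, ?_, h4⟩
      simpa [bracketStack, h1] using h3
    by_cases h2 : x = k
    · rcases opened with _ | ⟨o, rest⟩
      · simp only [bracketScan, h2, if_true, Nat.left_eq_add, one_ne_zero, if_false] at h
        rcases hr : (bracketScan k w (q + 1) []).2 with _ | ⟨y, l⟩
        · rw [hr] at h
          obtain rfl : q = p := by simpa using h
          exact ⟨[], w, by simp [h2], rfl, rfl, hr⟩
        · rw [hr, List.getLast?_cons_cons, ← hr] at h
          obtain ⟨u, v, rfl, rfl, h3, h4⟩ := ih _ _ _ h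
          refine ⟨x :: u, v, rfl, by simp only [List.length_cons]; omega, ?_, h4⟩
          simpa [bracketStack, h2] using h3
      · simp only [bracketScan, h2, if_true, Nat.left_eq_add, one_ne_zero, if_false] at h
        obtain ⟨u, v, rfl, rfl, h3, h4⟩ := ih _ _ _ h
        refine ⟨x :: u, v, rfl, by simp only [List.length_cons]; omega, ?_, h4⟩
        simpa [bracketStack, h2] using h3
    · simp only [bracketScan, h1, h2, if_false] at h
      obtain ⟨u, v, rfl, rfl, h3, h4⟩ := ih _ _ _ h
      refine ⟨x :: u, v, rfl, by simp only [List.length_cons]; omega, ?_, h4⟩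
      simpa [bracketStack, h1, h2] using h3

/-- In a word whose letters `k + 1` are all bracketed, no suffix has more letters `k + 1` than
letters `k`. -/
theorem count_drop_le_of_bracketStack_eq_nil {k : ℕ} {u : List ℕ} {q : ℕ} {opened : List ℕ}
    (h : bracketStack k u q opened = []) (t : ℕ) :
    (u.drop t).count (k + 1) ≤ (u.drop t).count k := by
  rw [← List.take_append_drop t u, bracketStack_append] at h
  have := length_bracketScan k (u.drop t) (q + (u.take t).length)
    (bracketStack k (u.take t) q opened)
  rw [h, List.length_nil] at this
  omega

/-- In a word whose letters `k` are all bracketed, no prefix has more letters `k` than letters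
`k + 1`. -/
theorem count_take_le_of_bracketScan_eq_nil {k : ℕ} {v : List ℕ} {q : ℕ}
    (h : (bracketScan k v q []).2 = []) (t : ℕ) :
    (v.take t).count k ≤ (v.take t).count (k + 1) := by
  rw [← List.take_append_drop t v, bracketScan_append] at h
  have := length_bracketScan k (v.take t) q []
  rw [(List.append_eq_nil_iff.1 h).1, List.length_nil] at this
  omega

/-- What bracketing says about the position `p` on which `f_k` acts, in terms of the numbers of
letters `k` and `k + 1` in the prefixes of the word. -/
theorem loweringPosition_spec {k : ℕ} {w : List ℕ} {p : ℕ} (h : loweringPosition k w = some p) :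
    w[p]? = some k ∧ nLeft k w p = (w.take p).count (k + 1) ∧
    w.count k = (w.take p).count k + 1 + nRight k w p ∧
    (∀ q ≤ p, (w.take p).count (k + 1) + (w.take q).count k ≤
      (w.take p).count k + (w.take q).count (k + 1)) ∧
    ∀ q, p < q → (w.take q).count k + (w.take p).count (k + 1) ≤
      (w.take q).count (k + 1) + (w.take p).count k + 1 := by
  obtain ⟨u, v, rfl, rfl, hu, hv⟩ := exists_split_of_getLast? k w 0 [] p h
  rw [Nat.zero_add] at *
  have hpairs : bracketedPairs k (u ++ k :: v) =
      (bracketScan k u 0 []).1 ++ (bracketScan k v (u.length + 1) []).1 := by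
    rw [bracketedPairs, bracketScan_append, hu]
    simp [bracketScan]
  have lu := length_bracketScan k u 0 []
  have lv := length_bracketScan k v (u.length + 1) []
  rw [hu, List.length_nil] at lu
  rw [hv, List.length_nil] at lv
  have mu := mem_bracketScan k u 0 []
  have mv := mem_bracketScan k v (u.length + 1) []
  have tu : (u ++ k :: v).take u.length = u := by simp
  rw [tu]
  refine ⟨by simp, ?_, ?_, ?_, ?_⟩
  · rw [nLeft, hpairs, List.countP_append, List.countP_eq_length.2, List.countP_eq_zero.2]
    · omega
    · intro x hx
      have := mv x hx
      simp only [decide_eq_true_eq]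
      omega
    · intro x hx
      have := mu x hx
      simp only [List.not_mem_nil, false_or] at this
      simp only [decide_eq_true_eq]
      omega
  · rw [nRight, hpairs, List.countP_append, List.countP_eq_zero.2, List.countP_eq_length.2,
      List.count_append, List.count_cons_self]
    · omega
    · intro x hx
      have := mv x hx
      simp only [List.not_mem_nil, false_or] at this
      simp only [decide_eq_true_eq]
      omega
    · intro x hx
      have := mu x hx
      simp only [decide_eq_true_eq]
      omega
  · intro q hq
    have h1 := count_drop_le_of_bracketStack_eq_nil hu q
    have h2 : (u ++ k :: v).take q = u.take q := by
      rw [List.take_append_of_le_length hq]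
    rw [h2]
    have h3 : ∀ x, u.count x = (u.take q).count x + (u.drop q).count x := by
      intro x
      rw [← List.count_append, List.take_append_drop]
    rw [h3 k, h3 (k + 1)]
    omega
  · intro q hq
    obtain ⟨t, rfl⟩ : ∃ t, q = u.length + (t + 1) := ⟨q - u.length - 1, by omega⟩
    have h1 := count_take_le_of_bracketScan_eq_nil hv t
    rw [List.take_length_add_append, List.take_succ_cons, List.count_append, List.count_append,
      List.count_cons_self, List.count_cons_of_ne (by omega)]
    omega

/-! ### Standardization and the arrow as counts of letters -/

/-- The number given by standardization to the letter at position `q` of a word of length `n` with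
letters `f 0, …, f (n - 1)`. -/
def stdRank (f : ℕ → ℕ) (n q : ℕ) : ℕ :=
  Nat.count (fun t => f t < f q) n + Nat.count (fun t => f t = f q) (q + 1)

theorem count_take_eq {w : List ℕ} (x : ℕ) {q : ℕ} (hq : q ≤ w.length) :
    (w.take q).count x = Nat.count (fun t => w.getD t 0 = x) q := by
  induction q with
  | zero => simp
  | succ q ih =>
    have hq' : q < w.length := hq
    rw [List.take_succ_eq_append_getElem hq', List.count_append, ih hq'.le, Nat.count_succ,
      List.getD_eq_getElem _ _ hq', List.count_singleton]
    simp

/-- Replacing a letter `k` at position `p` by `k + 1` changes the number of letters with the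
property `P` among the first `q` ones accordingly. -/
theorem count_update (f : ℕ → ℕ) (P : ℕ → Prop) [DecidablePred P] {k p : ℕ} (hp : f p = k)
    (q : ℕ) :
    Nat.count (fun t => P (if t = p then k + 1 else f t)) q + (if p < q ∧ P k then 1 else 0) =
      Nat.count (fun t => P (f t)) q + if p < q ∧ P (k + 1) then 1 else 0 := by
  induction q with
  | zero => simp
  | succ q ih =>
    rw [Nat.count_succ, Nat.count_succ]
    rcases Nat.lt_trichotomy p q with h | rfl | h
    · have h1 : q ≠ p := by omega
      have h2 : p < q + 1 := by omega
      simp only [h, h2, true_and, if_neg h1] at ih ⊢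
      omega
    · have h2 : p < p + 1 := by omega
      simp only [lt_irrefl, h2, true_and, false_and, if_true, if_false, hp] at ih ⊢
      omega
    · have h1 : q ≠ p := by omega
      have h2 : ¬ p < q + 1 := by omega
      have h3 : ¬ p < q := by omega
      simp only [h2, h3, false_and, if_neg h1, if_false] at ih ⊢
      omega

theorem count_lt_add_count_eq (f : ℕ → ℕ) (a n : ℕ) :
    Nat.count (fun t => f t < a) n + Nat.count (fun t => f t = a) n =
      Nat.count (fun t => f t < a + 1) n := by
  induction n with
  | zero => simp
  | succ n ih =>
    rw [Nat.count_succ, Nat.count_succ, Nat.count_succ, ← ih]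
    split_ifs <;> omega

theorem count_lt_mono (f : ℕ → ℕ) {a b : ℕ} (h : a ≤ b) (n : ℕ) :
    Nat.count (fun t => f t < a) n ≤ Nat.count (fun t => f t < b) n :=
  Nat.count_mono_left fun _ _ k => lt_of_lt_of_le k h

section arrow

variable {f : ℕ → ℕ} {n p k L R : ℕ}

/-- The number that a position receives from standardization, according to its letter. -/
theorem stdRank_cases (f : ℕ → ℕ) (k : ℕ) {q : ℕ} (hq : q < n) :
    (f q < k ∧ stdRank f n q ≤ Nat.count (fun t => f t < k) n) ∨
    (f q = k ∧ stdRank f n q =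
        Nat.count (fun t => f t < k) n + Nat.count (fun t => f t = k) q + 1 ∧
      Nat.count (fun t => f t = k) (q + 1) = Nat.count (fun t => f t = k) q + 1 ∧
      Nat.count (fun t => f t = k + 1) (q + 1) = Nat.count (fun t => f t = k + 1) q) ∨
    (f q = k + 1 ∧ stdRank f n q = Nat.count (fun t => f t < k) n +
        Nat.count (fun t => f t = k) n + Nat.count (fun t => f t = k + 1) q + 1 ∧
      Nat.count (fun t => f t = k) (q + 1) = Nat.count (fun t => f t = k) q ∧
      Nat.count (fun t => f t = k + 1) (q + 1) = Nat.count (fun t => f t = k + 1) q + 1) ∨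
    (k + 1 < f q ∧ Nat.count (fun t => f t < k) n + Nat.count (fun t => f t = k) n +
      Nat.count (fun t => f t = k + 1) n < stdRank f n q) := by
  have e0 := count_lt_add_count_eq f k n
  have e1 := count_lt_add_count_eq f (k + 1) n
  rcases Nat.lt_trichotomy (f q) k with h | h | h
  · left
    refine ⟨h, ?_⟩
    have h1 := count_lt_add_count_eq f (f q) n
    have h2 := count_lt_mono f (show f q + 1 ≤ k by omega) n
    have h3 := Nat.count_monotone (fun t => f t = f q) (show q + 1 ≤ n by omega)
    dsimp only [stdRank]
    omega
  · right; left
    refine ⟨h, ?_, ?_, ?_⟩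
    · rw [stdRank, Nat.count_succ, h, if_pos rfl]
      omega
    · rw [Nat.count_succ, if_pos h]
    · rw [Nat.count_succ, if_neg (by omega)]
      rfl
  · right; right
    rcases (show k + 1 ≤ f q from h).eq_or_lt with h | h
    · left
      refine ⟨h.symm, ?_, ?_, ?_⟩
      · rw [stdRank, Nat.count_succ, ← h, if_pos rfl]
        omega
      · rw [Nat.count_succ, if_neg (by omega)]
        rfl
      · rw [Nat.count_succ, if_pos h.symm]
    · right
      refine ⟨h, ?_⟩
      have h2 := count_lt_mono f (show k + 1 + 1 ≤ f q by omega) n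
      rw [stdRank, Nat.count_succ, if_pos rfl]
      omega

/-- When the `k` at position `p` becomes `k + 1`, the standardization changes by a cycle on the
letters `x, …, x + L + R`, where `x` is the number of the position `p`. -/
theorem stdRank_update (hp : f p = k) (hpn : p < n)
    (hL : Nat.count (fun t => f t = k + 1) p = L)
    (hR : Nat.count (fun t => f t = k) n = Nat.count (fun t => f t = k) p + 1 + R)
    (hn : L + R ≤ Nat.count (fun t => f t = k + 1) n) {q : ℕ} (hq : q < n) :
    (stdRank f n q < stdRank f n p ∧
      stdRank (fun t => if t = p then k + 1 else f t) n q = stdRank f n q) ∨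
    (q = p ∧ stdRank (fun t => if t = p then k + 1 else f t) n q = stdRank f n p + (L + R)) ∨
    (stdRank f n p < stdRank f n q ∧ stdRank f n q ≤ stdRank f n p + (L + R) ∧
      stdRank (fun t => if t = p then k + 1 else f t) n q + 1 = stdRank f n q) ∨
    (stdRank f n p + (L + R) < stdRank f n q ∧
      stdRank (fun t => if t = p then k + 1 else f t) n q = stdRank f n q) := by
  have u1 := count_update f (fun y => y < f q) hp n
  have u2 := count_update f (fun y => y = f q) hp (q + 1)
  have v1 := count_update f (fun y => y < k + 1) hp n
  have v2 := count_update f (fun y => y = k + 1) hp (p + 1)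
  have e0 := count_lt_add_count_eq f k n
  have mA := fun {s t : ℕ} (h : s ≤ t) => Nat.count_monotone (fun t => f t = k) h
  have mB := fun {s t : ℕ} (h : s ≤ t) => Nat.count_monotone (fun t => f t = k + 1) h
  have cp := stdRank_cases f k hpn
  have cq := stdRank_cases f k hq
  by_cases hqp : q = p
  · subst hqp
    right; left
    refine ⟨rfl, ?_⟩
    have hr : stdRank (fun t => if t = q then k + 1 else f t) n q =
        Nat.count (fun t => (if t = q then k + 1 else f t) < k + 1) n +
          Nat.count (fun t => (if t = q then k + 1 else f t) = k + 1) (q + 1) := by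
      simp only [stdRank, if_true]
    split_ifs at v1 v2 <;> omega
  have hr : stdRank (fun t => if t = p then k + 1 else f t) n q =
      Nat.count (fun t => (if t = p then k + 1 else f t) < f q) n +
        Nat.count (fun t => (if t = p then k + 1 else f t) = f q) (q + 1) := by
    simp only [stdRank, if_neg hqp]
  have hs : stdRank f n q = Nat.count (fun t => f t < f q) n +
    Nat.count (fun t => f t = f q) (q + 1) := rfl
  rcases Nat.lt_or_ge p q with hpq | hpq
  · have a1 := mA (show p + 1 ≤ q by omega)
    have b1 := mB (show p + 1 ≤ q by omega)
    have a2 := mA (show q + 1 ≤ n by omega)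
    have b2 := mB (show q + 1 ≤ n by omega)
    have h1 : p < q + 1 := by omega
    simp only [hpn, h1, true_and] at u1 u2
    split_ifs at u1 u2 <;> omega
  · have a1 := mA (show q + 1 ≤ p by omega)
    have b1 := mB (show q + 1 ≤ p by omega)
    have a2 := mA (show p + 1 ≤ n by omega)
    have b2 := mB (show p + 1 ≤ n by omega)
    have h1 : ¬ p < q + 1 := by omega
    simp only [hpn, h1, true_and, false_and, if_false] at u1 u2
    split_ifs at u1 <;> omega

/-- The arrow of the words `f` and `f'` (`f` with the `k` at position `p` changed to `k + 1`)
determines the arrow of their standardizations. The last two hypotheses say that all letters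
`k + 1` on the left of `p` and all letters `k` on the right of `p` are bracketed. -/
theorem arrowPositions_of_count {f' pos pos' : ℕ → ℕ} {i : ℕ} (hp : f p = k) (hpn : p < n)
    (hf' : f' = fun t => if t = p then k + 1 else f t)
    (hpos : ∀ q < n, pos (stdRank f n q) = q) (hpos' : ∀ q < n, pos' (stdRank f' n q) = q)
    (hsurj : ∀ v, 1 ≤ v → v ≤ n → ∃ q < n, stdRank f n q = v)
    (hsurj' : ∀ v, 1 ≤ v → v ≤ n → ∃ q < n, stdRank f' n q = v)
    (hi : stdRank f n p = i + L) (hm : 0 < L + R)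
    (hL : Nat.count (fun t => f t = k + 1) p = L)
    (hR : Nat.count (fun t => f t = k) n = Nat.count (fun t => f t = k) p + 1 + R)
    (hl : ∀ q ≤ p, Nat.count (fun t => f t = k + 1) p + Nat.count (fun t => f t = k) q ≤
      Nat.count (fun t => f t = k) p + Nat.count (fun t => f t = k + 1) q)
    (hr : ∀ q, p < q → q ≤ n →
      Nat.count (fun t => f t = k) q + Nat.count (fun t => f t = k + 1) p ≤
        Nat.count (fun t => f t = k + 1) q + Nat.count (fun t => f t = k) p + 1) :
    ArrowPositions n i (L + R) L pos pos' := by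
  have e0 := count_lt_add_count_eq f k n
  have e1 := count_lt_add_count_eq f (k + 1) n
  have e2 : Nat.count (fun t => f t < k + 1 + 1) n ≤ n := Nat.count_le _
  have mA := fun {s t : ℕ} (h : s ≤ t) => Nat.count_monotone (fun t => f t = k) h
  have mB := fun {s t : ℕ} (h : s ≤ t) => Nat.count_monotone (fun t => f t = k + 1) h
  have hBn : L + R ≤ Nat.count (fun t => f t = k + 1) n := by
    have := hr n hpn le_rfl
    omega
  have hAp : L ≤ Nat.count (fun t => f t = k) p := by
    have := hl 0 (Nat.zero_le _)
    simp only [Nat.count_zero] at this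
    omega
  have hx : i + L = Nat.count (fun t => f t < k) n + Nat.count (fun t => f t = k) p + 1 := by
    have := stdRank_cases f k hpn
    omega
  have hpx : pos (i + L) = p := hi ▸ hpos p hpn
  -- The letters `k` and `k + 1` of the word in terms of the letters of its standardization.
  have hk : ∀ v, i ≤ v → v ≤ i + (L + R) → ∃ q < n, pos v = q ∧ f q = k ∧
      v = Nat.count (fun t => f t < k) n + Nat.count (fun t => f t = k) q + 1 ∧
      Nat.count (fun t => f t = k) (q + 1) = Nat.count (fun t => f t = k) q + 1 ∧
      Nat.count (fun t => f t = k + 1) (q + 1) = Nat.count (fun t => f t = k + 1) q := by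
    intro v h1 h2
    obtain ⟨q, hq, rfl⟩ := hsurj v (by omega) (by omega)
    refine ⟨q, hq, hpos q hq, ?_⟩
    have := stdRank_cases f k hq
    omega
  have hk1 : ∀ v, i + (L + R) < v → v ≤ i + 2 * (L + R) → ∃ q < n, pos v = q ∧ f q = k + 1 ∧
      v = Nat.count (fun t => f t < k) n + Nat.count (fun t => f t = k) n +
        Nat.count (fun t => f t = k + 1) q + 1 ∧
      Nat.count (fun t => f t = k) (q + 1) = Nat.count (fun t => f t = k) q ∧
      Nat.count (fun t => f t = k + 1) (q + 1) = Nat.count (fun t => f t = k + 1) q + 1 := by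
    intro v h1 h2
    obtain ⟨q, hq, rfl⟩ := hsurj v (by omega) (by omega)
    refine ⟨q, hq, hpos q hq, ?_⟩
    have := stdRank_cases f k hq
    have := mA (show q + 1 ≤ n by omega)
    have := mB (show q + 1 ≤ n by omega)
    omega
  have hcyc : ∀ q < n, _ := fun q hq => stdRank_update hp hpn hL hR hBn hq
  rw [← hf', hi] at hcyc
  refine ⟨hm, by omega, by omega, by omega, ?_, ?_, ?_, ?_, ?_, ?_, ?_, ?_, ?_, ?_⟩
  · intro u v hu hu' hv hv' e
    obtain ⟨q, hq, rfl⟩ := hsurj u hu hu'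
    obtain ⟨q', hq', rfl⟩ := hsurj v hv hv'
    rw [hpos q hq, hpos q' hq'] at e
    rw [e]
  · intro u v hu huv hv
    obtain ⟨q, hq, h1, h2, h3, h4, h5⟩ := hk u hu (by omega)
    obtain ⟨q', hq', k1, k2, k3, k4, k5⟩ := hk v (by omega) hv
    rw [h1, k1]
    by_contra k
    have := mA (show q' ≤ q by omega)
    omega
  · intro u v hu huv hv
    obtain ⟨q, hq, h1, h2, h3, h4, h5⟩ := hk1 u (by omega) (by omega)
    obtain ⟨q', hq', k1, k2, k3, k4, k5⟩ := hk1 v (by omega) hv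
    rw [h1, k1]
    by_contra k
    have := mB (show q' ≤ q by omega)
    omega
  · intro t ht
    obtain ⟨q, hq, h1, h2, h3, h4, h5⟩ := hk (i + t) (by omega) (by omega)
    obtain ⟨q', hq', k1, k2, k3, k4, k5⟩ := hk1 (i + (L + R) + 1 + t) (by omega) (by omega)
    rw [h1, k1]
    by_contra hlt
    have hne : q ≠ q' := by
      rintro rfl
      omega
    have l1 := mA (show q + 1 ≤ q' by omega)
    have l2 : q' ≤ p := by
      by_contra h6
      have := mB (show p ≤ q' by omega)
      omega
    have := hl q' l2
    omega
  · intro t ht ht'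
    obtain ⟨q, hq, h1, h2, h3, h4, h5⟩ := hk (i + t) (by omega) (by omega)
    obtain ⟨q', hq', k1, k2, k3, k4, k5⟩ := hk1 (i + (L + R) + t) (by omega) (by omega)
    rw [h1, k1]
    by_contra hlt
    have l1 := mB (show q ≤ q' by omega)
    have l2 : p < q := by
      by_contra h6
      have := mA (show q ≤ p by omega)
      omega
    have := hr (q + 1) (by omega) (by omega)
    omega
  · intro ht
    obtain ⟨q', hq', k1, k2, k3, k4, k5⟩ := hk1 (i + (L + R) + L + 1) (by omega) (by omega)
    rw [hpx, k1]
    by_contra hlt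
    have hne : q' ≠ p := by
      rintro rfl
      omega
    have := mB (show q' + 1 ≤ p by omega)
    omega
  · intro v hv hv'
    obtain ⟨q, hq, rfl⟩ := hsurj' v hv (by omega)
    have h1 : stdRank f' n q = stdRank f n q := by
      have := hcyc q hq
      omega
    rw [hpos' q hq, h1, hpos q hq]
  · intro v hv hv'
    obtain ⟨q, hq, rfl⟩ := hsurj' v (by omega) hv'
    have h1 : stdRank f' n q = stdRank f n q := by
      have := hcyc q hq
      omega
    rw [hpos' q hq, h1, hpos q hq]
  · intro v hv hv'
    obtain ⟨q, hq, rfl⟩ := hsurj' v (by omega) (by omega)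
    have h1 : stdRank f' n q + 1 = stdRank f n q := by
      have := hcyc q hq
      omega
    rw [hpos' q hq, h1, hpos q hq]
  · have h1 : stdRank f' n p = i + L + (L + R) := by
      have := hcyc p hpn
      omega
    rw [← h1, hpos' p hpn, hpx]

end arrow

section tableau

variable {μ : YoungDiagram}

theorem rowWord_getD (b : SemistandardYoungTableau μ) {q r c : ℕ}
    (h : (readingCells μ)[q]? = some (r, c)) : (rowWord b).getD q 0 = b r c := by
  simp [rowWord, h]

/-- Equal letters of a semistandard tableau are read from left to right. -/
theorem before_iff_of_eq (b : SemistandardYoungTableau μ) {r c r' c' : ℕ} (h : (r, c) ∈ μ)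
    (h' : (r', c') ∈ μ) (e : b r c = b r' c') : Before (r, c) (r', c') ↔ c < c' := by
  have key : ∀ {r c r' c' : ℕ}, (r, c) ∈ μ → (r', c') ∈ μ → b r c = b r' c' →
      Before (r, c) (r', c') → c < c' := by
    intro r c r' c' h h' e k
    simp only [Before] at k
    rcases k with k | k
    · by_contra k'
      have h1 := b.col_strict k (μ.up_left_mem le_rfl (not_lt.1 k') h)
      have h2 : b r c' ≤ b r c := by
        rcases (not_lt.1 k').eq_or_lt with h3 | h3
        · rw [h3]
        · exact b.row_weak h3 h
      omega
    · exact k.2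
  refine ⟨key h h' e, fun k => ?_⟩
  rcases before_or_eq_or_before (r, c) (r', c') with k' | k' | k'
  · exact k'
  · obtain ⟨rfl, rfl⟩ := Prod.mk.inj k'
    omega
  · have := key h' h e.symm k'
    omega

/-- Standardization of tableaux is standardization of reading words. -/
theorem std_entry (b : SemistandardYoungTableau μ) {q r c : ℕ}
    (h : (readingCells μ)[q]? = some (r, c)) :
    (std b).entry r c = stdRank (fun t => (rowWord b).getD t 0) μ.card q := by
  have hm : (r, c) ∈ μ := mem_readingCells.1 (List.mem_of_getElem? h)
  have hq : q < μ.card := length_readingCells μ ▸ (List.getElem?_eq_some_iff.1 h).1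
  have h1 : (std b).entry r c = (cellsUpTo b r c).card := if_pos hm
  rw [h1, stdRank, Nat.count_eq_card_filter_range, Nat.count_eq_card_filter_range]
  rw [← Finset.card_union_of_disjoint]
  swap
  · rw [Finset.disjoint_left]
    intro t ht ht'
    have := (Finset.mem_filter.1 ht).2
    have := (Finset.mem_filter.1 ht').2
    omega
  symm
  have hget : ∀ t, t < μ.card → ∃ x, (readingCells μ)[t]? = some x := fun t ht =>
    ⟨_, List.getElem?_eq_getElem (length_readingCells μ ▸ ht)⟩
  refine Finset.card_bij (fun t _ => ((readingCells μ)[t]?).getD (0, 0)) ?_ ?_ ?_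
  · intro t ht
    rw [Finset.mem_union, Finset.mem_filter, Finset.mem_filter, Finset.mem_range,
      Finset.mem_range] at ht
    obtain ⟨⟨r', c'⟩, hx⟩ := hget t (by omega)
    have hm' : (r', c') ∈ μ := mem_readingCells.1 (List.mem_of_getElem? hx)
    rw [rowWord_getD b hx, rowWord_getD b h] at ht
    rw [hx, Option.getD_some, cellsUpTo, Finset.mem_filter]
    refine ⟨hm', ?_⟩
    rcases ht with ht | ht
    · exact Or.inl ht.2
    · right
      refine ⟨ht.2, ?_⟩
      by_contra k
      have := (before_iff_of_getElem? h hx).1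
        ((before_iff_of_eq b hm hm' ht.2.symm).2 (not_le.1 k))
      omega
  · intro t ht t' ht' e
    rw [Finset.mem_union, Finset.mem_filter, Finset.mem_filter, Finset.mem_range,
      Finset.mem_range] at ht ht'
    obtain ⟨x, hx⟩ := hget t (by omega)
    obtain ⟨x', hx'⟩ := hget t' (by omega)
    simp only [hx, hx', Option.getD_some] at e
    subst e
    have h1 := (before_iff_of_getElem? hx hx').2
    have h2 := (before_iff_of_getElem? hx' hx).2
    have h3 := Before.irrefl x
    rcases Nat.lt_trichotomy t t' with k | k | k
    · exact absurd (h1 k) h3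
    · exact k
    · exact absurd (h2 k) h3
  · rintro ⟨r', c'⟩ hx
    obtain ⟨hm', hx⟩ := Finset.mem_filter.1 hx
    dsimp only at hx
    obtain ⟨t, ht, e⟩ := exists_getElem?_readingCells (r := r') (c := c') hm'
    refine ⟨t, ?_, by rw [e]; rfl⟩
    rw [Finset.mem_union, Finset.mem_filter, Finset.mem_filter, Finset.mem_range,
      Finset.mem_range, rowWord_getD b e, rowWord_getD b h]
    rcases hx with hx | ⟨hx, hc⟩
    · exact Or.inl ⟨ht, hx⟩
    · refine Or.inr ⟨?_, hx⟩
      by_contra k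
      have := (before_iff_of_eq b hm hm' hx.symm).1
        ((before_iff_of_getElem? h e).2 (by omega))
      omega

theorem length_rowWord (b : SemistandardYoungTableau μ) : (rowWord b).length = μ.card := by
  rw [rowWord, List.length_map, length_readingCells]

theorem position_stdRank (b : SemistandardYoungTableau μ) {q : ℕ} (hq : q < μ.card) :
    position (std b) (stdRank (fun t => (rowWord b).getD t 0) μ.card q) = q := by
  have h : (readingCells μ)[q]? = some ((readingCells μ)[q]'(length_readingCells μ ▸ hq)) :=
    List.getElem?_eq_getElem _
  rw [← std_entry b h]
  exact position_of_getElem? h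

theorem exists_stdRank_eq (b : SemistandardYoungTableau μ) {v : ℕ} (h1 : 1 ≤ v)
    (h2 : v ≤ μ.card) :
    ∃ q < μ.card, stdRank (fun t => (rowWord b).getD t 0) μ.card q = v := by
  obtain ⟨r, c, h, e⟩ := exists_entry_eq (std b) h1 h2
  obtain ⟨q, hq, e'⟩ := exists_getElem?_readingCells h
  exact ⟨q, hq, by rw [← std_entry b e', e]⟩

/-- Every edge of the crystal skeleton has the combinatorics of `ArrowPositions`. -/
theorem SkeletonEdge.arrowPositions {T T' : StandardTableau μ} {i m : ℕ}
    (h : SkeletonEdge T T' i m) :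
    ∃ L, ArrowPositions μ.card i m L (position T) (position T') := by
  obtain ⟨hm, N, -, b, ⟨-, rfl⟩, b', ⟨-, rfl⟩, k, -, -, hlow, p, hp, hπ, rfl⟩ := h
  have hlow' : rowWord b' = (rowWord b).set p (k + 1) := by
    rw [Lowers, lowerWord, hp] at hlow
    exact (Option.some_inj.1 hlow).symm
  obtain ⟨s1, s2, s3, s4, s5⟩ := loweringPosition_spec hp
  have hlen := length_rowWord b
  have hpn : p < μ.card := by
    rw [← hlen]
    exact (List.getElem?_eq_some_iff.1 s1).1
  have hcount : ∀ x q, q ≤ μ.card → ((rowWord b).take q).count x =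
      Nat.count (fun t => (rowWord b).getD t 0 = x) q := fun x q hq =>
    count_take_eq x (hlen ▸ hq)
  have hfp : (rowWord b).getD p 0 = k := by rw [List.getD_eq_getElem?_getD, s1]; rfl
  refine ⟨nLeft k (rowWord b) p, arrowPositions_of_count
    (f := fun t => (rowWord b).getD t 0) (f' := fun t => (rowWord b').getD t 0) hfp hpn ?_
    (fun q hq => position_stdRank b hq) (fun q hq => position_stdRank b' hq)
    (fun v h1 h2 => exists_stdRank_eq b h1 h2) (fun v h1 h2 => exists_stdRank_eq b' h1 h2)
    ?_ hm ?_ ?_ ?_ ?_⟩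
  · funext t
    rw [hlow', List.getD_eq_getElem?_getD, List.getElem?_set, List.getD_eq_getElem?_getD]
    by_cases ht : t = p
    · subst ht
      simp [hlen, hpn]
    · rw [if_neg (Ne.symm ht), if_neg ht]
  · have e : (readingCells μ)[p]? = some ((readingCells μ)[p]'(length_readingCells μ ▸ hpn)) :=
      List.getElem?_eq_getElem _
    rw [← std_entry b e]
    rw [rowWord, List.getElem?_map, e] at hπ
    exact Option.some_inj.1 hπ
  · rw [← hcount _ _ hpn.le, s2]
  · rw [← hcount _ _ hpn.le, ← hcount _ _ le_rfl, ← hlen, List.take_length, s3]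
  · intro q hq
    rw [← hcount _ _ hpn.le, ← hcount _ _ hpn.le, ← hcount _ _ (by omega),
      ← hcount _ _ (by omega)]
    exact s4 q hq
  · intro q hq hq'
    rw [← hcount _ _ hpn.le, ← hcount _ _ hpn.le, ← hcount _ _ (by omega),
      ← hcount _ _ (by omega)]
    exact s5 q hq

end tableau

/-! ### Compositions and their boundaries -/

/-- The intervals `(s₀, s₁], (s₁, s₂], …` between consecutive elements of a list. -/
def consecutiveIocs : List ℕ → List (Finset ℕ)
  | [] => []
  | [_] => []
  | a :: b :: l => Finset.Ioc a b :: consecutiveIocs (b :: l)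

theorem consecutiveIocs_append (P : List ℕ) (u : ℕ) (R : List ℕ) :
    consecutiveIocs (P ++ u :: R) = consecutiveIocs (P ++ [u]) ++ consecutiveIocs (u :: R) := by
  induction P with
  | nil => rfl
  | cons a P ih =>
    rcases P with _ | ⟨b, P⟩
    · rfl
    · simpa [consecutiveIocs] using ih

theorem length_consecutiveIocs (P : List ℕ) (u : ℕ) :
    (consecutiveIocs (P ++ [u])).length = P.length := by
  induction P with
  | nil => rfl
  | cons a P ih =>
    rcases P with _ | ⟨b, P⟩
    · rfl
    · simpa [consecutiveIocs] using ih

theorem consecutiveIocs_map_range (l : ℕ) : ∀ f : ℕ → ℕ,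
    consecutiveIocs ((List.range (l + 1)).map f) =
      (List.range l).map fun j => Finset.Ioc (f j) (f (j + 1)) := by
  induction l with
  | zero => intro f; rfl
  | succ l ih =>
    intro f
    have h := ih fun j => f (j + 1)
    have e : ∀ (r : ℕ) (g : ℕ → ℕ), (List.range (r + 1)).map g =
        g 0 :: (List.range r).map fun j => g (j + 1) := by
      intro r g
      rw [List.range_succ_eq_map, List.map_cons, List.map_map]
      rfl
    have e' : ∀ g : ℕ → Finset ℕ, (List.range (l + 1)).map g =
        g 0 :: (List.range l).map fun j => g (j + 1) := by
      intro g
      rw [List.range_succ_eq_map, List.map_cons, List.map_map]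
      rfl
    rw [e', ← h, e, e]
    rfl

section boundaryList

variable {n : ℕ} (α : Composition n)

/-- The partial sums `0 = s₀ < s₁ < … < s_ℓ = n` of a composition of `n` with `ℓ` parts. -/
def boundaryList : List ℕ := (List.range (α.length + 1)).map α.sizeUpTo

theorem blockList_eq : blockList α = consecutiveIocs (boundaryList α) :=
  (consecutiveIocs_map_range α.length α.sizeUpTo).symm

theorem pairwise_boundaryList : (boundaryList α).Pairwise (· < ·) := by
  rw [boundaryList, List.pairwise_map, List.pairwise_iff_getElem]
  intro a b ha hb hab
  rw [List.getElem_range, List.getElem_range]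
  rw [List.length_range] at hb
  have h1 : α.sizeUpTo a < α.sizeUpTo (a + 1) := α.sizeUpTo_strict_mono (by omega)
  exact h1.trans_le (α.monotone_sizeUpTo hab)

theorem length_boundaryList : (boundaryList α).length = α.length + 1 := by simp [boundaryList]

variable {α}

theorem sizeUpTo_of_boundaryList {P R : List ℕ} {x : ℕ} (h : boundaryList α = P ++ x :: R) :
    α.sizeUpTo P.length = x := by
  have h1 : (boundaryList α)[P.length]? = some x := by rw [h]; simp
  rw [boundaryList, List.getElem?_map] at h1
  obtain ⟨y, hy, rfl⟩ := Option.map_eq_some_iff.1 h1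
  obtain ⟨_, hy⟩ := List.getElem?_eq_some_iff.1 hy
  rw [List.getElem_range] at hy
  rw [hy]

end boundaryList

variable {μ : YoungDiagram}

theorem mem_boundaryList_Des {T : StandardTableau μ} {x : ℕ} :
    x ∈ boundaryList (Des T) ↔ x = 0 ∨ x = μ.card ∨ IsDescent T x := by
  set c : CompositionAsSet μ.card :=
    { boundaries := Finset.univ.filter fun x =>
        x = 0 ∨ x = Fin.last μ.card ∨ IsDescent T (x : ℕ)
      zero_mem := by simp
      getLast_mem := by simp }
  have hmem : ∀ y : Fin μ.card.succ,
      y ∈ c.boundaries ↔ (y : ℕ) = 0 ∨ (y : ℕ) = μ.card ∨ IsDescent T (y : ℕ) := by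
    intro y
    change y ∈ Finset.univ.filter _ ↔ _
    rw [Finset.mem_filter, Fin.ext_iff, Fin.ext_iff]
    simp only [Finset.mem_univ, true_and]
    rfl
  have hDes : Des T = c.toComposition := rfl
  have h1 : x ∈ boundaryList (Des T) ↔
      ∃ i < c.boundaries.card, (c.blocks.take i).sum = x := by
    rw [boundaryList, List.mem_map, c.card_boundaries_eq_succ_length, hDes, c.toComposition_length]
    simp only [List.mem_range]
    rfl
  have hle : ∀ i, (c.blocks.take i).sum ≤ μ.card := fun i => c.toComposition.sizeUpTo_le i
  rw [h1]
  constructor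
  · rintro ⟨i, hi, rfl⟩
    have := c.mem_boundaries_iff_exists_blocks_sum_take_eq
      (j := ⟨(c.blocks.take i).sum, Nat.lt_succ_of_le (hle i)⟩)
    exact (hmem _).1 (this.2 ⟨i, hi, rfl⟩)
  · intro h
    have hx : x ≤ μ.card := by
      rcases h with rfl | rfl | h
      · exact Nat.zero_le _
      · exact le_rfl
      · have := isDescent_iff.1 h
        omega
    have h2 : (⟨x, Nat.lt_succ_of_le hx⟩ : Fin μ.card.succ) ∈ c.boundaries :=
      (hmem _).2 h
    exact c.mem_boundaries_iff_exists_blocks_sum_take_eq.1 h2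

/-- The boundaries of the descent compositions at the two ends of an edge. -/
theorem mem_boundaryList_iff {T T' : StandardTableau μ} {i m : ℕ} (h : SkeletonEdge T T' i m) :
    ¬ (HasRectangle T (i - 1) (i + 2 * m) ∧ HasRectangle T i (i + 2 * m + 1)) ∧
    (HasRectangle T (i - 1) (i + 2 * m) → 1 ≤ i - 1 ∧ i - 1 ∈ boundaryList (Des T)) ∧
    (HasRectangle T i (i + 2 * m + 1) → i + 2 * m + 1 ≤ μ.card) ∧
    (∀ x ∈ boundaryList (Des T), i ≤ x → x ≤ i + 2 * m → x < μ.card → x = i + m ∨ x = i + 2 * m) ∧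
    (HasRectangle T i (i + 2 * m + 1) → i + 2 * m ∉ boundaryList (Des T)) ∧
    i + m ∈ boundaryList (Des T) ∧
    ∀ x, x ∈ boundaryList (Des T') ↔
      (x ∈ boundaryList (Des T) ∧ x ≠ i + m ∧
        ¬ (x + 1 = i ∧ HasRectangle T (i - 1) (i + 2 * m))) ∨
      x + 1 = i + m ∨ (x = i + 2 * m ∧ HasRectangle T i (i + 2 * m + 1)) := by
  obtain ⟨L, hA⟩ := h.arrowPositions
  have hm := hA.m_pos
  have hi := hA.i_pos
  have hn := hA.le_n
  have hleft : HasRectangle T (i - 1) (i + 2 * m) ↔ 1 ≤ i - 1 ∧ L = 0 ∧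
      position T i < position T (i - 1) ∧ position T (i - 1) < position T (i + 1) := by
    rw [hasRectangle_iff (s := m + 1) (by omega) (by omega)]
    constructor
    · rintro ⟨h1, -, h2⟩
      exact ⟨h1, (hA.rectangle_left_iff h1).1 h2⟩
    · rintro ⟨h1, h2⟩
      exact ⟨h1, hn, (hA.rectangle_left_iff h1).2 h2⟩
  have hright : HasRectangle T i (i + 2 * m + 1) ↔ i + 2 * m + 1 ≤ μ.card ∧ L = m ∧
      position T (i + 2 * m) < position T (i + 2 * m + 1) ∧
      position T (i + 2 * m + 1) < position T (i + m) := by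
    rw [hasRectangle_iff (s := m + 1) (by omega) (by omega)]
    constructor
    · rintro ⟨-, h1, h2⟩
      exact ⟨h1, (hA.rectangle_right_iff h1).1 h2⟩
    · rintro ⟨h1, h2⟩
      exact ⟨hi, h1, (hA.rectangle_right_iff h1).2 h2⟩
  -- The bracketed pair `(i + m, i + m + 1)` or a later one makes `i + m` a descent.
  have hdesc : position T (i + m + 1) < position T (i + m) := by
    rcases Nat.eq_zero_or_pos L with rfl | k
    · rcases Nat.lt_or_ge 1 m with k1 | k1
      · exact (hA.right 1 (by omega) (by omega)).trans
          (hA.lower _ _ (by omega) (by omega) le_rfl)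
      · obtain rfl : m = 1 := by omega
        exact hA.right 1 (by omega) le_rfl
    · exact (hA.left 0 k).trans (hA.lower _ _ le_rfl (by omega) le_rfl)
  have hno : ∀ x, i ≤ x → x < i + 2 * m → x ≠ i + m → ¬ position T (x + 1) < position T x := by
    intro x h1 h2 h3
    rcases Nat.lt_or_ge x (i + m) with k | k
    · exact (hA.lower x (x + 1) h1 (by omega) (by omega)).not_gt
    · exact (hA.upper x (x + 1) (by omega) (by omega) (by omega)).not_gt
  refine ⟨?_, ?_, ?_, ?_, ?_, ?_, ?_⟩
  · rw [hleft, hright]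
    omega
  · rw [hleft, mem_boundaryList_Des, isDescent_iff, show i - 1 + 1 = i by omega]
    omega
  · rw [hright]
    exact fun h => h.1
  · intro x hx h1 h2 h3
    rw [mem_boundaryList_Des, isDescent_iff] at hx
    have := hno x h1
    omega
  · rw [hright, mem_boundaryList_Des, isDescent_iff]
    omega
  · rw [mem_boundaryList_Des, isDescent_iff]
    omega
  · intro x
    rw [mem_boundaryList_Des, mem_boundaryList_Des, isDescent_iff, isDescent_iff, hleft, hright]
    by_cases hx : 1 ≤ x ∧ x + 1 ≤ μ.card
    · rw [hA.descent_iff hx.1 hx.2]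
      by_cases hxi : x + 1 = i
      · subst hxi
        simp only [Nat.add_sub_cancel, true_and]
        omega
      · by_cases hxm : x = i + 2 * m
        · subst hxm
          have : position T (i + 2 * m) ≠ position T (i + 2 * m + 1) := fun e => by
            have := hA.inj _ _ (by omega) (by omega) (by omega) (by omega) e
            omega
          omega
        · omega
    · omega

/-- A strictly increasing list is determined by its elements. -/
theorem eq_append_of_mem_iff {S A M B : List ℕ} {a b : ℕ} (hS : S.Pairwise (· < ·))
    (hA : A.Pairwise (· < ·)) (hM : M.Pairwise (· < ·)) (hB : B.Pairwise (· < ·)) (hab : a ≤ b)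
    (hAa : ∀ x ∈ A, x < a) (hMab : ∀ x ∈ M, a ≤ x ∧ x < b) (hBb : ∀ x ∈ B, b ≤ x)
    (h : ∀ x, x ∈ S ↔ x ∈ A ∨ x ∈ M ∨ x ∈ B) : S = A ++ (M ++ B) := by
  refine hS.eq_of_mem_iff ?_ fun x => by rw [h, List.mem_append, List.mem_append]
  rw [List.pairwise_append, List.pairwise_append]
  refine ⟨hA, ⟨hM, hB, fun x hx y hy => (hMab x hx).2.trans_le (hBb y hy)⟩, fun x hx y hy => ?_⟩
  rcases List.mem_append.1 hy with k | k
  · exact (hAa x hx).trans_le (hMab y k).1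
  · exact ((hAa x hx).trans_le hab).trans_le (hBb y k)

end CrystalSkeleton

open CrystalSkeleton
theorem mainTheorem3 (μ : YoungDiagram) (T T' : StandardTableau μ) (i m : ℕ)
    (hedge : SkeletonEdge T T' i m) :
    (∃ j, Finset.Ico i (i + m) ∪ {i + m} ⊆ block (Des T) j) ∧
    ∀ j, Finset.Ico i (i + m) ∪ {i + m} ⊆ block (Des T) j →
      j + 1 < (Des T).length ∧
      Finset.Ioc (i + m) (i + 2 * m) ⊆ block (Des T) (j + 1) ∧
      -- length-preserving edges
      ((¬ HasRectangle T (i - 1) (i + 2 * m) ∧ ¬ HasRectangle T i (i + 2 * m + 1)) →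
        (Des T').length = (Des T).length ∧
        blockList (Des T') =
          (blockList (Des T)).take j ++
            [block (Des T) j \ {i + m}, block (Des T) (j + 1) ∪ {i + m}] ++
            (blockList (Des T)).drop (j + 2)) ∧
      -- length-increasing edges
      (HasRectangle T i (i + 2 * m + 1) →
        (Des T').length = (Des T).length + 1 ∧
        blockList (Des T') =
          (blockList (Des T)).take j ++
            [block (Des T) j \ {i + m}, Finset.Ioc (i + m) (i + 2 * m) ∪ {i + m},
              block (Des T) (j + 1) \ Finset.Ioc (i + m) (i + 2 * m)] ++
            (blockList (Des T)).drop (j + 2)) ∧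
      -- length-decreasing edges
      (HasRectangle T (i - 1) (i + 2 * m) →
        (Des T').length + 1 = (Des T).length ∧
        1 ≤ j ∧
        block (Des T) j = Finset.Ico i (i + m) ∪ {i + m} ∧
        blockList (Des T') =
          (blockList (Des T)).take (j - 1) ++
            [block (Des T) (j - 1) ∪ Finset.Ico i (i + m),
              block (Des T) (j + 1) ∪ {i + m}] ++
            (blockList (Des T)).drop (j + 2)) := by
  obtain ⟨f1, f2, f3, f4, f5, f6, f7⟩ := mem_boundaryList_iff hedge
  obtain ⟨L, hA⟩ := hedge.arrowPositions
  have hm := hA.m_pos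
  have hi := hA.i_pos
  have hn := hA.le_n
  have hS := pairwise_boundaryList (Des T)
  have hS' := pairwise_boundaryList (Des T')
  have h0 : 0 ∈ boundaryList (Des T) := mem_boundaryList_Des.2 (Or.inl rfl)
  have hlast : μ.card ∈ boundaryList (Des T) := mem_boundaryList_Des.2 (Or.inr (Or.inl rfl))
  -- The boundaries `u < i + m < v` are consecutive.
  obtain ⟨P, u, v, Q, hPQ⟩ : ∃ P u v Q, boundaryList (Des T) = P ++ u :: (i + m) :: v :: Q := by
    obtain ⟨P, Q, e⟩ := List.append_of_mem f6
    rw [e] at hS h0 hlast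
    rcases List.eq_nil_or_concat P with rfl | ⟨P, u, rfl⟩
    · rcases List.mem_cons.1 h0 with k | k
      · omega
      · have := List.rel_of_pairwise_cons hS k
        omega
    rcases Q with _ | ⟨v, Q⟩
    · rw [List.pairwise_append] at hS
      rcases List.mem_append.1 hlast with k | k
      · have := hS.2.2 _ k _ (List.mem_singleton_self _)
        omega
      · have := List.mem_singleton.1 k
        omega
    · exact ⟨P, u, v, Q, by rw [e]; simp⟩
  have hmem : ∀ x, x ∈ boundaryList (Des T) ↔
      x ∈ P ∨ x = u ∨ x = i + m ∨ x = v ∨ x ∈ Q := by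
    intro x
    rw [hPQ]
    simp
  have hsort := hS
  rw [hPQ] at hsort
  simp only [List.pairwise_append, List.pairwise_cons, List.mem_cons] at hsort
  obtain ⟨s1, ⟨s2, s3, s4, s5⟩, s6⟩ := hsort
  have hui : u < i := by
    by_contra k
    have h1 := s2 (i + m) (Or.inl rfl)
    have := f4 u ((hmem u).2 (by simp)) (by omega) (by omega) (by omega)
    omega
  have hvi : i + 2 * m ≤ v := by
    by_contra k
    have h1 := s3 v (Or.inl rfl)
    have := f4 v ((hmem v).2 (by simp)) (by omega) (by omega) (by omega)
    omega
  have hsu : (Des T).sizeUpTo P.length = u := sizeUpTo_of_boundaryList hPQ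
  have hsc : (Des T).sizeUpTo (P.length + 1) = i + m := by
    have := sizeUpTo_of_boundaryList (P := P ++ [u]) (R := v :: Q) (x := i + m)
      (by rw [hPQ]; simp)
    simpa using this
  have hsv : (Des T).sizeUpTo (P.length + 1 + 1) = v := by
    have := sizeUpTo_of_boundaryList (P := P ++ [u, i + m]) (R := Q) (x := v)
      (by rw [hPQ]; simp)
    simpa using this
  have hlen : (Des T).length + 1 = P.length + (Q.length + 3) := by
    rw [← length_boundaryList, hPQ]
    simp
  have hblock : block (Des T) P.length = Finset.Ioc u (i + m) := by rw [block, hsu, hsc]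
  have hblock' : block (Des T) (P.length + 1) = Finset.Ioc (i + m) v := by rw [block, hsc, hsv]
  have hA' : (P ++ [u]).Pairwise (· < ·) := by
    have := hS
    rw [hPQ, show P ++ u :: (i + m) :: v :: Q = (P ++ [u]) ++ ((i + m) :: v :: Q) by simp] at this
    exact (List.pairwise_append.1 this).1
  have hB' : (v :: Q).Pairwise (· < ·) := List.pairwise_cons.2 ⟨s4, s5⟩
  have hAi : ∀ x ∈ P, x < u := fun x hx => s6 x hx u (Or.inl rfl)
  have hBi : ∀ x ∈ v :: Q, v ≤ x := by
    intro x hx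
    rcases List.mem_cons.1 hx with rfl | k
    · exact le_rfl
    · exact (s4 x k).le
  have hmem : ∀ x, x ∈ boundaryList (Des T) ↔ (x ∈ P ∨ x = u) ∨ x = i + m ∨ x ∈ v :: Q := by
    intro x
    rw [hmem, List.mem_cons, or_assoc]
  have hlist : blockList (Des T) = consecutiveIocs (P ++ [u]) ++
      Finset.Ioc u (i + m) :: Finset.Ioc (i + m) v :: consecutiveIocs (v :: Q) := by
    rw [blockList_eq, hPQ, consecutiveIocs_append]
    rfl
  have hlistlen := length_consecutiveIocs P u
  have htake : (blockList (Des T)).take P.length = consecutiveIocs (P ++ [u]) := by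
    rw [hlist, ← hlistlen, List.take_left]
  have hdrop : (blockList (Des T)).drop (P.length + 2) = consecutiveIocs (v :: Q) := by
    rw [hlist, ← hlistlen, List.drop_length_add_append]
    rfl
  constructor
  · refine ⟨P.length, ?_⟩
    rw [hblock]
    intro x hx
    simp only [Finset.mem_union, Finset.mem_Ico, Finset.mem_singleton, Finset.mem_Ioc] at hx ⊢
    omega
  intro j hj
  obtain rfl : j = P.length := by
    have h1 : i ∈ block (Des T) j := hj (by simp)
    have h2 : i + m ∈ block (Des T) j := hj (by simp)
    rw [block, Finset.mem_Ioc] at h1 h2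
    rcases Nat.lt_trichotomy j P.length with k | k | k
    · have := (Des T).monotone_sizeUpTo (show j + 1 ≤ P.length from k)
      omega
    · exact k
    · have := (Des T).monotone_sizeUpTo (show P.length + 1 ≤ j from k)
      omega
  refine ⟨by omega, ?_, ?_, ?_, ?_⟩
  · rw [hblock']
    exact Finset.Ioc_subset_Ioc le_rfl hvi
  · rintro ⟨r1, r2⟩
    have e : boundaryList (Des T') = (P ++ [u]) ++ ([i + m - 1] ++ (v :: Q)) := by
      refine eq_append_of_mem_iff (a := i) (b := v) hS' hA' (List.pairwise_singleton _ _) hB'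
        (by omega) ?_ ?_ hBi fun x => ?_
      · intro x hx
        rcases List.mem_append.1 hx with k | k
        · exact (hAi x k).trans hui
        · exact (List.mem_singleton.1 k).trans_lt hui
      · simp only [List.mem_singleton, forall_eq]
        omega
      · have k1 := hAi x
        have k2 := hBi x
        rw [f7, hmem, List.mem_append, List.mem_singleton, List.mem_singleton]
        generalize HasRectangle T (i - 1) (i + 2 * m) = r1' at *
        generalize HasRectangle T i (i + 2 * m + 1) = r2' at *
        clear * - r1 r2 k1 k2 hui hvi hm
        by_cases l1 : x ∈ P <;> by_cases l2 : x ∈ v :: Q <;>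
          simp only [l1, l2, r1, r2, forall_true_left, and_false, not_false_eq_true, and_true,
            true_or, or_true, or_false, false_or, true_and, iff_true] at k1 k2 ⊢ <;> omega
    refine ⟨?_, ?_⟩
    · have := length_boundaryList (Des T')
      rw [e] at this
      simp only [List.length_append, List.length_cons, List.length_nil] at this
      omega
    · rw [htake, hdrop, blockList_eq, e, List.append_assoc, List.singleton_append,
        consecutiveIocs_append, hblock, hblock']
      simp only [consecutiveIocs, List.append_assoc, List.cons_append, List.nil_append]
      congr 2
      · ext x
        simp only [Finset.mem_Ioc, Finset.mem_sdiff, Finset.mem_singleton]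
        omega
      · congr 1
        ext x
        simp only [Finset.mem_Ioc, Finset.mem_union, Finset.mem_singleton]
        omega
  · intro r2
    have r1 : ¬ HasRectangle T (i - 1) (i + 2 * m) := fun r1 => f1 ⟨r1, r2⟩
    have hv : i + 2 * m < v := by
      refine lt_of_le_of_ne hvi fun k => f5 r2 ?_
      rw [hmem, k]
      simp
    have e : boundaryList (Des T') = (P ++ [u]) ++ ([i + m - 1, i + 2 * m] ++ (v :: Q)) := by
      refine eq_append_of_mem_iff (a := i) (b := v) hS' hA' ?_ hB'
        (by omega) ?_ ?_ hBi fun x => ?_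
      · simp only [List.pairwise_cons, List.mem_singleton, forall_eq]
        refine ⟨by omega, by simp⟩
      · intro x hx
        rcases List.mem_append.1 hx with k | k
        · exact (hAi x k).trans hui
        · exact (List.mem_singleton.1 k).trans_lt hui
      · simp only [List.mem_cons, List.not_mem_nil, or_false, forall_eq_or_imp, forall_eq]
        omega
      · have k1 := hAi x
        have k2 := hBi x
        rw [f7, hmem, List.mem_append, List.mem_singleton, List.mem_cons (a := x) (b := i + m - 1),
          List.mem_singleton]
        generalize HasRectangle T (i - 1) (i + 2 * m) = r1' at *
        generalize HasRectangle T i (i + 2 * m + 1) = r2' at *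
        clear * - r1 r2 k1 k2 hui hv hm
        by_cases l1 : x ∈ P <;> by_cases l2 : x ∈ v :: Q <;>
          simp only [l1, l2, r1, r2, forall_true_left, and_false, not_false_eq_true, and_true,
            true_or, or_true, or_false, false_or, true_and, iff_true] at k1 k2 ⊢ <;> omega
    refine ⟨?_, ?_⟩
    · have := length_boundaryList (Des T')
      rw [e] at this
      simp only [List.length_append, List.length_cons, List.length_nil] at this
      omega
    · rw [htake, hdrop, blockList_eq, e, List.append_assoc, List.singleton_append,
        consecutiveIocs_append, hblock, hblock']
      simp only [consecutiveIocs, List.append_assoc, List.cons_append, List.nil_append]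
      congr 2
      · ext x
        simp only [Finset.mem_Ioc, Finset.mem_sdiff, Finset.mem_singleton]
        omega
      · congr 1
        · ext x
          simp only [Finset.mem_Ioc, Finset.mem_union, Finset.mem_singleton]
          omega
        · congr 1
          ext x
          simp only [Finset.mem_Ioc, Finset.mem_sdiff]
          omega
  · intro r1
    have r2 : ¬ HasRectangle T i (i + 2 * m + 1) := fun r2 => f1 ⟨r1, r2⟩
    obtain ⟨g1, g2⟩ := f2 r1
    have hu : u = i - 1 := by
      rcases (hmem _).1 g2 with (k | k) | k | k
      · have := hAi _ k
        omega
      · exact k.symm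
      · omega
      · have := hBi _ k
        omega
    have hP : P ≠ [] := by
      rintro rfl
      rcases (hmem _).1 h0 with (k | k) | k | k
      · simp at k
      · omega
      · omega
      · have := hBi _ k
        omega
    -- `i - 1 ≥ 1` is the boundary before `i + m`; it is lost, and `u'` is the one before it.
    obtain ⟨P', u', rfl⟩ := (List.eq_nil_or_concat P).resolve_left hP
    simp only [List.concat_eq_append, List.length_append, List.length_singleton,
      List.append_assoc, List.mem_append, List.mem_singleton] at *
    have hu' : u' < u := hAi u' (Or.inr rfl)
    have hs0 : (Des T).sizeUpTo P'.length = u' :=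
      sizeUpTo_of_boundaryList (R := u :: (i + m) :: v :: Q) (by rw [hPQ]; simp)
    have hblock'' : block (Des T) P'.length = Finset.Ioc u' u := by rw [block, hs0, hsu]
    have htake' : (blockList (Des T)).take P'.length = consecutiveIocs (P' ++ [u']) := by
      rw [hlist, List.singleton_append, consecutiveIocs_append, ← length_consecutiveIocs P' u',
        List.append_assoc, List.take_left]
    have e : boundaryList (Des T') = (P' ++ [u']) ++ ([i + m - 1] ++ (v :: Q)) := by
      refine eq_append_of_mem_iff (a := i) (b := v) hS' s1 (List.pairwise_singleton _ _) hB'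
        (by omega) ?_ ?_ hBi fun x => ?_
      · intro x hx
        have := hAi x (by simpa using hx)
        omega
      · simp only [List.mem_singleton, forall_eq]
        omega
      · have k1 := hAi x
        have k2 := hBi x
        rw [f7, hmem, List.mem_append, List.mem_singleton, List.mem_singleton]
        generalize HasRectangle T (i - 1) (i + 2 * m) = r1' at *
        generalize HasRectangle T i (i + 2 * m + 1) = r2' at *
        clear * - r1 r2 k1 k2 hui hvi hm hu hu' g1
        by_cases l1 : x ∈ P' <;> by_cases l2 : x ∈ v :: Q <;>
          simp only [l1, l2, r1, r2, forall_true_left, and_false, and_true, true_or,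
            or_true, or_false, false_or, true_and, iff_true] at k1 k2 ⊢ <;> omega
    refine ⟨?_, by omega, ?_, ?_⟩
    · have := length_boundaryList (Des T')
      rw [e] at this
      simp only [List.length_append, List.length_cons, List.length_nil] at this
      omega
    · rw [hblock]
      ext x
      simp only [Finset.mem_Ioc, Finset.mem_union, Finset.mem_Ico, Finset.mem_singleton]
      omega
    · rw [Nat.add_sub_cancel, htake', hdrop, blockList_eq, e, List.append_assoc,
        List.singleton_append, consecutiveIocs_append, hblock'', hblock']
      simp only [consecutiveIocs, List.cons_append, List.nil_append]
      congr 2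
      · ext x
        simp only [Finset.mem_Ioc, Finset.mem_union, Finset.mem_Ico]
        omega
      · congr 1
        ext x
        simp only [Finset.mem_Ioc, Finset.mem_union, Finset.mem_singleton]
        omega
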